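/- Let $d\ge 3$, $0\le k\le n$, write $[n]=\{1,\dots,n\}$ and let $P_k[n]$ be the set of $k$-element subsets of $[n]$. For $\kappa=(\kappa_1,\dots,\kappa_n)\in\mathbb R^n$ and $x\in\mathbb R^d$ put $\varphi_\alpha(x)=\sum_{r=1}^d\kappa_\alpha^r x_r$, and let $K=(\kappa_\alpha^{i-1})_{\alpha\in[n],\,i\in[k]}$ be the Vandermonde matrix. For a real $k\times n$ matrix $B$ of rank $k$ let $\Delta_B(I)$ (resp. $\Delta_K(I)$) be the maximal minor of $B$ with columns (resp. of $K$ with rows) $I\in P_k[n]$, and let $\mathfrak G_B=\{I\in P_k[n]:\Delta_B(I)\ne 0\}$. A signature for $B$ is a map $\Sigma:\mathfrak G_B\to\{\pm1\}$; it is called solitonic (for $B$ and $\kappa$) if it maps the $\tau$-function $\tau_B(x)=\sum_{I}\Delta_B(I)\Delta_K(I)\,e^{\sum_{\alpha\in I}\varphi_\alpha(x)}$ to a solution of the bilinear KP II equation, that is, if $$\tau(x)=\sum_{I\in\mathfrak G_B}\Sigma(I)\,\Delta_B(I)\,\Delta_K(I)\,e^{\sum_{\alpha\in I}\varphi_\alpha(x)}$$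 satisfies $(D_{x_1}^4-4D_{x_1}D_{x_3}+3D_{x_2}^2)\,\tau\cdot\tau=0$ on $\mathbb R^d$, where $D_{x_i}$ are the Hirota derivatives. A signature $\tilde\Sigma:P_k[n]\to\{\pm1\}$ defined on all of $P_k[n]$ is called solitonic (for $\kappa$) if for every real $k\times n$ matrix $B$ of rank $k$ (in particular for those with $\mathfrak G_B=P_k[n]$) the restriction of $\tilde\Sigma$ to $\mathfrak G_B$ is solitonic for $B$ and $\kappa$. Assume that $\kappa$ is generic: the $\kappa_\alpha$ are pairwise distinct, and whenever $I,J,I',J'\in P_k[n]$ satisfy $\sum_{\alpha\in I}\kappa_\alpha^u+\sum_{\beta\in J}\kappa_\beta^u=\sum_{\gamma\in I'}\kappa_\gamma^u+\sum_{\delta\in J'}\kappa_\delta^u$ for all $u=1,\dots,d$, then $I\cup J=I'\cup J'$ and $I\cap J=I'\cap J'$. Let $A$ be a real $k\times n$ matrix of rank $k$ and $\Sigma:\mathfrak G_A\to\{\pm1\}$ a signature that is solitonic for $A$ and $\kappa$. Then there is a map $\tilde\Sigma:P_k[n]\to\{\pm1\}$ with $\tilde\Sigma(I)=\Sigma(I)$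 for all $I\in\mathfrak G_A$ that is solitonic for $\kappa$. -/

import Mathlib

open Finset

noncomputable section

namespace KPSigns

/-- The collection `P_k[n]` of `k`-element subsets of the index set of the `n` columns. -/
abbrev KSubset (n k : ℕ) : Type := {I : Finset (Fin n) // #I = k}

/-- The maximal minor of the `k × n` matrix `A` whose columns are indexed by `I`,
taken in increasing order. -/
def colMinor {n k : ℕ} (A : Matrix (Fin k) (Fin n) ℝ) (I : KSubset n k) : ℝ :=
  (A.submatrix id (I.1.orderEmbOfFin I.2)).det

/-- The `n × k` Vandermonde matrix of the soliton parameters `κ`. -/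
def vdmMatrix {n : ℕ} (k : ℕ) (κ : Fin n → ℝ) : Matrix (Fin n) (Fin k) ℝ :=
  Matrix.of fun α i => κ α ^ (i : ℕ)

/-- The maximal minor of the Vandermonde matrix whose rows are indexed by `I`,
taken in increasing order. -/
def vdmMinor {n k : ℕ} (κ : Fin n → ℝ) (I : KSubset n k) : ℝ :=
  ((vdmMatrix k κ).submatrix (I.1.orderEmbOfFin I.2) id).det

/-- The phase `φ_α(x) = κ_α x_1 + κ_α ^ 2 x_2 + ... + κ_α ^ d x_d`; the coordinate `x_r`
is `x` at the index `r - 1`. -/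
def phase {n d : ℕ} (κ : Fin n → ℝ) (α : Fin n) (x : Fin d → ℝ) : ℝ :=
  ∑ r : Fin d, κ α ^ ((r : ℕ) + 1) * x r

/-- The set of those `k`-subsets whose maximal minor of `A` does not vanish. -/
def nonvanishing {n k : ℕ} (A : Matrix (Fin k) (Fin n) ℝ) : Set (KSubset n k) :=
  {I | colMinor A I ≠ 0}

/-- A choice of signs (signature) for the nonvanishing maximal minors of `A`;
the group `ℤˣ` is `{1, -1}`. -/
abbrev Signature {n k : ℕ} (A : Matrix (Fin k) (Fin n) ℝ) : Type :=
  nonvanishing A → ℤˣ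

open Classical in
/-- The exponential sum obtained from
`τ(x) = det (A Θ(x) K) = ∑_I Δ_A(I) Δ_K(I) exp (∑_{α ∈ I} φ_α(x))` when the term indexed by `I`
is multiplied by the sign `S I`. Terms with `Δ_A(I) = 0` are zero, and are left out. -/
def signedTau {n k d : ℕ} (κ : Fin n → ℝ) (A : Matrix (Fin k) (Fin n) ℝ) (S : Signature A)
    (x : Fin d → ℝ) : ℝ :=
  ∑ I : nonvanishing A,
    (((S I : ℤˣ) : ℤ) : ℝ) * (colMinor A I.1 * vdmMinor κ I.1) *
      Real.exp (∑ α ∈ I.1.1, phase κ α x)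

/-- The operator `∂/∂x_i - ∂/∂y_i` on functions of a pair `(x, y)` of points. -/
def hirotaDiff {d : ℕ} (i : Fin d) (F : (Fin d → ℝ) → (Fin d → ℝ) → ℝ) :
    (Fin d → ℝ) → (Fin d → ℝ) → ℝ :=
  fun x y => lineDeriv ℝ (fun x' => F x' y) x (Pi.single i 1)
    - lineDeriv ℝ (fun y' => F x y') y (Pi.single i 1)

/-- The bilinear operator `D_KP(f, g) = (D_{x_1}^4 - 4 D_{x_1} D_{x_3} + 3 D_{x_2}^2) f ⬝ g`,
where the Hirota derivatives act on `f(x) g(y)` before `y` is set equal to `x`. -/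
def hirotaKP {d : ℕ} (hd : 3 ≤ d) (f g : (Fin d → ℝ) → ℝ) (x : Fin d → ℝ) : ℝ :=
  let i₁ : Fin d := ⟨0, by omega⟩
  let i₂ : Fin d := ⟨1, by omega⟩
  let i₃ : Fin d := ⟨2, by omega⟩
  let F : (Fin d → ℝ) → (Fin d → ℝ) → ℝ := fun u v => f u * g v
  (hirotaDiff i₁)^[4] F x x - 4 * hirotaDiff i₁ (hirotaDiff i₃ F) x x
    + 3 * (hirotaDiff i₂)^[2] F x x

/-- A signature for the nonvanishing minors of `A` is solitonic if it turns the `τ`-function of `A`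
into a solution of the bilinear KP II equation. -/
def IsSolitonic {n k d : ℕ} (hd : 3 ≤ d) (κ : Fin n → ℝ) (A : Matrix (Fin k) (Fin n) ℝ)
    (S : Signature A) : Prop :=
  ∀ x : Fin d → ℝ, hirotaKP hd (signedTau κ A S) (signedTau κ A S) x = 0

/-- A signature on the whole of `P_k[n]` is solitonic if it turns the `τ`-function of every
full-rank `k × n` matrix, in particular of those without vanishing maximal minors, into a solution
of the bilinear KP II equation. -/
def IsCompleteSolitonic {n k d : ℕ} (hd : 3 ≤ d) (κ : Fin n → ℝ) (S : KSubset n k → ℤˣ) : Prop :=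
  ∀ B : Matrix (Fin k) (Fin n) ℝ, B.rank = k → IsSolitonic hd κ B (fun I => S I.1)

/-- Generic soliton parameters: they are pairwise distinct, and two products of exponentials
`exp (∑_{α ∈ A} φ_α) exp (∑_{β ∈ B} φ_β)` with `A`, `B` in `P_k[n]` coincide only if the two pairs
have the same union and the same intersection. -/
def IsGeneric {n : ℕ} (k d : ℕ) (κ : Fin n → ℝ) : Prop :=
  Function.Injective κ ∧
    ∀ A B C D : KSubset n k,
      (∀ u ∈ Finset.Icc 1 d,
        ∑ α ∈ A.1, κ α ^ u + ∑ β ∈ B.1, κ β ^ u = ∑ γ ∈ C.1, κ γ ^ u + ∑ δ ∈ D.1, κ δ ^ u) →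
      A.1 ∪ B.1 = C.1 ∪ D.1 ∧ A.1 ∩ B.1 = C.1 ∩ D.1

end KPSigns

end

/-! The idea is that the signs must come from column rescalings: there are signs `e` and `s i` such
that `Σ(I) = e * ∏ i ∈ I, s i` on every basis `I` of the column matroid of `A`. This formula makes
sense for all `k`-subsets. Multiplying column `i` of any matrix `B` by `s i` multiplies its minors
by the products, and the global sign enters the bilinear equation only through `e * e = 1`. So the
extension is solitonic as soon as every unsigned `τ`-function is a solution
(`isCompleteSolitonic_prod`, `hirotaKP_tau_eq_zero`).

On a pair of exponentials the KP operator acts by multiplication with `kpSymbol`. Linear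
independence of characters and genericity split the equation by union and intersection of `(I, J)`.
For `#(I ∩ J) = k - 2` this leaves a three-term relation, satisfied by both the unsigned and the
signed coefficients, in which the Vandermonde minors and the symbols are nonzero. Hence exactly one
nonzero term is impossible, and two nonzero terms must carry the same sign product. With basis
exchange this is `SignsCompatible`.

The product formula (`exists_prod_eq`) is then pure matroid combinatorics. Fix a basis `B₀` and
enlarge a set `T ⊇ B₀` one element `j` at a time, keeping the signs normalised to `1` on the bases
inside `T`. The sign of `exch B₀ y j` depends only on the component of `y` in the exchange graph of
`B₀` inside `T` (`exch_eq_of_exchWalk`), so flipping whole components repairs all single exchanges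
at `B₀`. Constancy on single exchanges at one basis propagates to all bases (`eq_of_exch_eq`). -/

namespace KPSigns

/-! ### Compatible signs on the bases of a matroid. -/

section Exchange

variable {E : Type*} [DecidableEq E]

/-- The set obtained from `B` by removing `i` and adding `j`. -/
def exch (B : Finset E) (i j : E) : Finset E := insert j (B.erase i)

theorem exch_swap {B : Finset E} {i i' j j' : E} (hi' : i' ∈ B) (hj : j ∉ B)
    (hj' : j' ∉ B) : exch (exch B i j) i' j' = exch (exch B i j') i' j := by
  have h1 : i' ≠ j' := by rintro rfl; exact hj' hi'
  have h2 : i' ≠ j := by rintro rfl; exact hj hi'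
  ext x
  simp only [exch, mem_insert, mem_erase]
  grind

theorem exch_exch_cancel {B : Finset E} {i j j' : E} (hj : j ∉ B) :
    exch (exch B i j) j j' = exch B i j' := by
  ext x
  simp only [exch, mem_insert, mem_erase]
  grind

theorem mem_exch_of_ne {B : Finset E} {i j x : E} (hx : x ∈ B) (h : x ≠ i) : x ∈ exch B i j := by
  simp [exch, hx, h]

theorem notMem_exch {B : Finset E} {i j x : E} (hx : x ∉ B) (h : x ≠ j) : x ∉ exch B i j := by
  simp [exch, hx, h]

theorem exch_subset {B T : Finset E} {i j : E} (hB : B ⊆ T) (hj : j ∈ T) : exch B i j ⊆ T :=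
  insert_subset hj ((erase_subset _ _).trans hB)

/-- A family `𝔅` of bases and signs `f` on it that satisfy the two-element exchange property, the
exchange property, and the sign condition imposed by the three-term Plücker relations. -/
structure SignsCompatible (𝔅 : Finset E → Prop) (f : Finset E → ℤˣ) : Prop where
  pairing : ∀ (N : Finset E) (a b c d : E), a ∉ N → b ∉ N → c ∉ N → d ∉ N →
    a ≠ b → a ≠ c → a ≠ d → b ≠ c → b ≠ d → c ≠ d →
    𝔅 (insert a (insert b N)) → 𝔅 (insert c (insert d N)) →
    (𝔅 (insert a (insert c N)) ∧ 𝔅 (insert b (insert d N))) ∨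
      (𝔅 (insert a (insert d N)) ∧ 𝔅 (insert b (insert c N)))
  mul_eq : ∀ (N : Finset E) (a b c d : E), a ∉ N → b ∉ N → c ∉ N → d ∉ N →
    a ≠ b → a ≠ c → a ≠ d → b ≠ c → b ≠ d → c ≠ d →
    𝔅 (insert a (insert b N)) → 𝔅 (insert c (insert d N)) →
    𝔅 (insert a (insert c N)) → 𝔅 (insert b (insert d N)) →
    f (insert a (insert b N)) * f (insert c (insert d N)) =
      f (insert a (insert c N)) * f (insert b (insert d N))
  exchange : ∀ B B' : Finset E, 𝔅 B → 𝔅 B' → ∀ c ∈ B', c ∉ B →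
    ∃ x ∈ B, x ∉ B' ∧ 𝔅 (exch B x c)

namespace SignsCompatible

variable {𝔅 : Finset E → Prop} {f : Finset E → ℤˣ}

/-- All six sets arise from the common core `B \ {i, i'}` by adding two of `i, i', j, j'`, so these
are the axioms `pairing` and `mul_eq` rewritten in terms of exchanges. -/
theorem square_relations (h : SignsCompatible 𝔅 f) {B : Finset E} {i i' j j' : E} (hi : i ∈ B)
    (hi' : i' ∈ B) (hj : j ∉ B) (hj' : j' ∉ B) (hii : i ≠ i') (hjj : j ≠ j') :
    (𝔅 B → 𝔅 (exch (exch B i j) i' j') →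
      (𝔅 (exch B i j) ∧ 𝔅 (exch B i' j')) ∨ (𝔅 (exch B i j') ∧ 𝔅 (exch B i' j))) ∧
    (𝔅 (exch B i j) → 𝔅 (exch B i' j') →
      (𝔅 B ∧ 𝔅 (exch (exch B i j) i' j')) ∨ (𝔅 (exch B i j') ∧ 𝔅 (exch B i' j))) ∧
    (𝔅 B → 𝔅 (exch (exch B i j) i' j') → 𝔅 (exch B i j) → 𝔅 (exch B i' j') →
      f B * f (exch (exch B i j) i' j') = f (exch B i j) * f (exch B i' j')) ∧
    (𝔅 (exch B i j) → 𝔅 (exch B i' j') → 𝔅 (exch B i j') → 𝔅 (exch B i' j) →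
      f (exch B i j) * f (exch B i' j') = f (exch B i j') * f (exch B i' j)) := by
  obtain ⟨N, hN⟩ : ∃ N, N = (B.erase i).erase i' := ⟨_, rfl⟩
  have e0 : B = insert i (insert i' N) := by ext x; simp only [hN, mem_insert, mem_erase]; grind
  have e1 : exch (exch B i j) i' j' = insert j (insert j' N) := by
    ext x; simp only [hN, exch, mem_insert, mem_erase]; grind
  have e2 : exch B i j = insert i' (insert j N) := by
    ext x; simp only [hN, exch, mem_insert, mem_erase]; grind
  have e3 : exch B i' j' = insert i (insert j' N) := by
    ext x; simp only [hN, exch, mem_insert, mem_erase]; grind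
  have e4 : exch B i j' = insert i' (insert j' N) := by
    ext x; simp only [hN, exch, mem_insert, mem_erase]; grind
  have e5 : exch B i' j = insert i (insert j N) := by
    ext x; simp only [hN, exch, mem_insert, mem_erase]; grind
  have n1 : i ∉ N := by simp [hN]
  have n2 : i' ∉ N := by simp [hN]
  have n3 : j ∉ N := by simp [hN, hj]
  have n4 : j' ∉ N := by simp [hN, hj']
  have d1 : i ≠ j := by rintro rfl; exact hj hi
  have d2 : i ≠ j' := by rintro rfl; exact hj' hi
  have d3 : i' ≠ j := by rintro rfl; exact hj hi'
  have d4 : i' ≠ j' := by rintro rfl; exact hj' hi'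
  rw [e1, e2, e3, e4, e5, e0]
  refine ⟨fun a b => ?_, fun a b => ?_, fun a b c d => ?_, fun a b c d => ?_⟩
  · have := h.pairing N i i' j j' n1 n2 n3 n4 hii d1 d2 d3 d4 hjj a b
    tauto
  · have := h.pairing N i' j i j' n2 n3 n1 n4 d3 hii.symm d4 d1.symm hjj d2 a b
    rw [insert_comm i' i] at this
    rw [insert_comm i j]
    tauto
  · have := h.mul_eq N i i' j' j n1 n2 n4 n3 hii d2 d1 d4 d3 hjj.symm a
      (by rwa [insert_comm]) d c
    rw [insert_comm j j', this, mul_comm]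
  · have := h.mul_eq N i' j j' i n2 n3 n4 n1 d3 d4 hii.symm hjj d1.symm d2.symm a
      (by rwa [insert_comm]) c (by rwa [insert_comm])
    rwa [insert_comm j' i, insert_comm j i] at this

/-- If the two single exchanges `i → j`, `i' → j'` give bases, but the crossed ones do not, then
the double exchange gives a basis. -/
theorem double_exch (h : SignsCompatible 𝔅 f) {B : Finset E} {i i' j j' : E} (hi : i ∈ B)
    (hi' : i' ∈ B) (hj : j ∉ B) (hj' : j' ∉ B) (h1 : 𝔅 (exch B i j))
    (h2 : 𝔅 (exch B i' j')) (h3 : ¬ (𝔅 (exch B i j') ∧ 𝔅 (exch B i' j))) :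
    𝔅 (exch (exch B i j) i' j') ∧
      f B * f (exch (exch B i j) i' j') = f (exch B i j) * f (exch B i' j') := by
  have hii : i ≠ i' := by rintro rfl; exact h3 ⟨h2, h1⟩
  have hjj : j ≠ j' := by rintro rfl; exact h3 ⟨h1, h2⟩
  obtain ⟨-, r2, r3, -⟩ := h.square_relations hi hi' hj hj' hii hjj
  have := (r2 h1 h2).resolve_right h3
  exact ⟨this.2, r3 this.1 this.2 h1 h2⟩

/-- If all single exchanges at a basis `B` inside `T` keep the sign, then the same is true at every
neighbouring basis inside `T`. -/
theorem exch_eq_of_neighbor (h : SignsCompatible 𝔅 f) {T B : Finset E} {x c : E} (hB : 𝔅 B)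
    (hone : ∀ i ∈ B, ∀ j ∈ T, j ∉ B → 𝔅 (exch B i j) → f (exch B i j) = f B)
    (hx : x ∈ B) (hcT : c ∈ T) (hc : c ∉ B) {i j : E} (hi : i ∈ exch B x c)
    (hjT : j ∈ T) (hj : j ∉ exch B x c) (hb : 𝔅 (exch (exch B x c) i j)) :
    f (exch (exch B x c) i j) = f B := by
  have hjc : j ≠ c := by rintro rfl; exact hj (by simp [exch])
  rcases eq_or_ne i c with rfl | hic
  · rw [exch_exch_cancel hc] at hb ⊢
    by_cases hjB : j ∈ B
    · have : j = x := by
        by_contra hne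
        exact hj (mem_exch_of_ne hjB hne)
      rw [this, exch, insert_erase hx]
    · exact hone x hx j hjT hjB hb
  have hiB : i ∈ B ∧ i ≠ x := by
    simp only [exch, mem_insert, mem_erase] at hi
    tauto
  by_cases hjB : j ∈ B
  · have hjx : j = x := by
      by_contra hne
      exact hj (mem_exch_of_ne hjB hne)
    have : exch (exch B x c) i j = exch B i c := by
      ext y; simp only [exch, mem_insert, mem_erase]; grind
    rw [this] at hb ⊢
    exact hone i hiB.1 c hcT hc hb
  · obtain ⟨r1, -, r3, -⟩ := h.square_relations hx hiB.1 hc hjB hiB.2.symm hjc.symm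
    obtain ⟨-, -, r3', -⟩ := h.square_relations hx hiB.1 hjB hc hiB.2.symm hjc
    have hs := exch_swap (i := x) hiB.1 hc hjB
    rcases r1 hB hb with ⟨g1, g2⟩ | ⟨g1, g2⟩
    · have := r3 hB hb g1 g2
      rw [hone _ hx _ hcT hc g1, hone _ hiB.1 _ hjT hjB g2] at this
      exact mul_left_cancel this
    · have := r3' hB (hs ▸ hb) g1 g2
      rw [hone _ hx _ hjT hjB g1, hone _ hiB.1 _ hcT hc g2, ← hs] at this
      exact mul_left_cancel this

/-- If all single exchanges at a basis `B` inside `T` keep the sign, then the sign is constant on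
the bases inside `T`. -/
theorem eq_of_exch_eq (h : SignsCompatible 𝔅 f) {T : Finset E} (m : ℕ) :
    ∀ B B' : Finset E, 𝔅 B → 𝔅 B' → B ⊆ T → B' ⊆ T → #(B' \ B) = m →
      (∀ i ∈ B, ∀ j ∈ T, j ∉ B → 𝔅 (exch B i j) → f (exch B i j) = f B) → f B' = f B := by
  induction m with
  | zero =>
    intro B B' hB hB' hBT hBT' hm _
    have hsub : B' ⊆ B := by simpa [sdiff_eq_empty_iff_subset] using hm
    rcases eq_or_ne B B' with rfl | hne
    · rfl
    · obtain ⟨c, hc, hc'⟩ := exists_of_ssubset (hsub.ssubset_of_ne hne.symm)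
      obtain ⟨x, hx, hx', -⟩ := h.exchange B' B hB' hB c hc hc'
      exact absurd (hsub hx) hx'
  | succ m ih =>
    intro B B' hB hB' hBT hBT' hm hone
    obtain ⟨c, hc⟩ : (B' \ B).Nonempty := by rw [← card_pos]; omega
    obtain ⟨hc1, hc2⟩ := mem_sdiff.1 hc
    obtain ⟨x, hx, hx', hxc⟩ := h.exchange B B' hB hB' c hc1 hc2
    have hfx := hone x hx c (hBT' hc1) hc2 hxc
    rw [← hfx]
    -- The base point moves to the neighbour `exch B x c`, one step closer to `B'`; the hypothesis
    -- on single exchanges moves along by `exch_eq_of_neighbor`.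
    refine ih _ _ hxc hB' (exch_subset hBT (hBT' hc1)) hBT' ?_ ?_
    · have : B' \ exch B x c = (B' \ B).erase c := by
        ext y
        rcases eq_or_ne y x with rfl | hy
        · simp [exch, hx']
        · simp only [exch, mem_sdiff, mem_insert, mem_erase]
          tauto
      rw [this, card_erase_of_mem hc, hm, Nat.add_sub_cancel]
    · intro i hi j hjT hj hb
      rw [hfx]
      exact h.exch_eq_of_neighbor hB hone hx (hBT' hc1) hc2 hi hjT hj hb

/-- Walks of length `p` between elements of `B` in the graph where `x` and `z` are joined if they
can be exchanged for the same element of `T \ B`. -/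
def _root_.KPSigns.ExchWalk (𝔅 : Finset E → Prop) (T B : Finset E) : ℕ → E → E → Prop
  | 0, x, y => x = y
  | p + 1, x, y => ∃ c z, c ∈ T ∧ c ∉ B ∧ z ∈ B ∧ 𝔅 (exch B x c) ∧ 𝔅 (exch B z c) ∧
      ExchWalk 𝔅 T B p z y

/-- A walk with no vertex close to `x` survives the exchange of `x` for `c₀`. -/
theorem exchWalk_exch (h : SignsCompatible 𝔅 f) {T B : Finset E} {x y c₀ : E} (hx : x ∈ B)
    (hc₀ : c₀ ∉ B) (hxc : 𝔅 (exch B x c₀)) (p : ℕ)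
    (hmin : ∀ q ≤ p, ¬ ExchWalk 𝔅 T B q x y) :
    ∀ q ≤ p, ∀ z ∈ B, ExchWalk 𝔅 T B q z y → ExchWalk 𝔅 T (exch B x c₀) q z y := by
  intro q
  induction q with
  | zero => intro _ z _ hw; exact hw
  | succ q ih =>
    rintro hq z hz ⟨c, w, hcT, hcB, hwB, hzc, hwc, hw⟩
    -- Otherwise `x` could enter the walk at `w` and reach `y` too early. With this crossed exchange
    -- missing, `double_exch` carries each edge over to the new basis.
    have key : ¬ 𝔅 (exch B x c) := fun hxc' => hmin (q + 1) hq ⟨c, w, hcT, hcB, hwB, hxc', hwc, hw⟩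
    have hne : c ≠ c₀ := by rintro rfl; exact key hxc
    have hwx : w ≠ x := by rintro rfl; exact key hwc
    refine ⟨c, w, hcT, notMem_exch hcB hne, mem_exch_of_ne hwB hwx, ?_, ?_, ih (by omega) w hwB hw⟩
    · exact (h.double_exch hx hz hc₀ hcB hxc hzc fun hh => key hh.1).1
    · exact (h.double_exch hx hwB hc₀ hcB hxc hwc fun hh => key hh.1).1

/-- If the sign is trivial on the bases inside `T`, then two exchanges for `j ∉ T` from connected
elements have the same sign. -/
theorem exch_eq_of_exchWalk (h : SignsCompatible 𝔅 f) {T : Finset E} {j : E} (hjT : j ∉ T)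
    (hT : ∀ B, 𝔅 B → B ⊆ T → f B = 1) (p : ℕ) :
    ∀ (B : Finset E) (x y : E), 𝔅 B → B ⊆ T → x ∈ B → y ∈ B → 𝔅 (exch B x j) →
      𝔅 (exch B y j) → ExchWalk 𝔅 T B p x y → f (exch B x j) = f (exch B y j) := by
  induction p using Nat.strong_induction_on with
  | _ p ih =>
    intro B x y hB hBT hx hy hxj hyj hw
    have hjB : j ∉ B := fun hj => hjT (hBT hj)
    by_cases hmin : ∃ q < p, ExchWalk 𝔅 T B q x y
    · obtain ⟨q, hq, hwq⟩ := hmin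
      exact ih q hq B x y hB hBT hx hy hxj hyj hwq
    push Not at hmin
    match p, ih, hmin, hw with
    | 0, _, _, hw => rw [show x = y from hw]
    | p + 1, ih, hmin, hw =>
      obtain ⟨c, z, hcT, hcB, hzB, hxc, hzc, hw⟩ := hw
      have hcj : c ≠ j := by rintro rfl; exact hjT hcT
      have hfxc := hT _ hxc (exch_subset hBT hcT)
      have hfzc := hT _ hzc (exch_subset hBT hcT)
      -- If `z` can also be exchanged for `j`, one sign relation compares `x` with `z`, and the
      -- shorter walk from `z` finishes. If not, the comparison is made at the basis `exch B x c`: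
      -- there `z` and `y` can both be exchanged for `j`, and the rest of the minimal walk survives.
      by_cases hzj : 𝔅 (exch B z j)
      · rw [← ih p (by omega) B z y hB hBT hzB hy hzj hyj hw]
        rcases eq_or_ne x z with rfl | hxz
        · rfl
        have := (h.square_relations hx hzB hjB hcB hxz hcj.symm).2.2.2 hxj hzc hxc hzj
        rwa [hfxc, hfzc, mul_one, one_mul] at this
      · have hxz : x ≠ z := by rintro rfl; exact hzj hxj
        have hxy : x ≠ y := fun e => hmin 0 (by omega) e
        have hp : p ≠ 0 := by
          rintro rfl
          have e : z = y := hw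
          exact hzj (e ▸ hyj)
        have hyc : ¬ 𝔅 (exch B y c) := fun hyc =>
          hmin 1 (by omega) ⟨c, y, hcT, hcB, hy, hxc, hyc, rfl⟩
        have hB1 : exch B x c ⊆ T := exch_subset hBT hcT
        obtain ⟨a1, a2⟩ := h.double_exch hx hzB hjB hcB hxj hzc fun hh => hzj hh.2
        obtain ⟨b1, b2⟩ := h.double_exch hx hy hcB hjB hxc hyj fun hh => hyc hh.2
        rw [exch_swap hzB hjB hcB] at a1 a2
        have := ih p (by omega) (exch B x c) z y hxc hB1 (mem_exch_of_ne hzB hxz.symm)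
          (mem_exch_of_ne hy hxy.symm) a1 b1
          (h.exchWalk_exch hx hcB hxc p (fun q hq => hmin q (by omega)) p le_rfl z hzB hw)
        rw [hT B hB hBT, hfzc, one_mul, mul_one] at a2
        rw [hT B hB hBT, hfxc, one_mul, one_mul] at b2
        rw [← a2, this, b2]

/-- Both sides of `mul_eq` use `a, b, c, d` once and `N` twice, so they change by the same factor.
-/
theorem gauge (h : SignsCompatible 𝔅 f) (e : ℤˣ) (s : E → ℤˣ) :
    SignsCompatible 𝔅 fun B => e * f B * ∏ i ∈ B, s i where
  pairing := h.pairing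
  exchange := h.exchange
  mul_eq N a b c d ha hb hc hd hab hac had hbc hbd hcd h1 h2 h3 h4 := by
    have := h.mul_eq N a b c d ha hb hc hd hab hac had hbc hbd hcd h1 h2 h3 h4
    rw [prod_insert (by simp [ha, hab]), prod_insert hb, prod_insert (by simp [hc, hcd]),
      prod_insert hd, prod_insert (by simp [ha, hac]), prod_insert hc,
      prod_insert (by simp [hb, hbd]), prod_insert hd]
    calc _ = e * e * (f (insert a (insert b N)) * f (insert c (insert d N))) * s a * s b * s c *
          s d * (∏ i ∈ N, s i) * (∏ i ∈ N, s i) := by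
            simp only [mul_assoc, mul_comm, mul_left_comm]
      _ = _ := by rw [this]; simp only [mul_assoc, mul_comm, mul_left_comm]

theorem _root_.KPSigns.exchWalk_snoc {T B : Finset E} (p : ℕ) :
    ∀ {x z w c : E}, ExchWalk 𝔅 T B p x z → c ∈ T → c ∉ B → w ∈ B → 𝔅 (exch B z c) →
      𝔅 (exch B w c) → ExchWalk 𝔅 T B (p + 1) x w := by
  induction p with
  | zero =>
    intro x z w c hw h1 h2 h3 h4 h5
    have hw : x = z := hw
    subst hw
    exact ⟨c, w, h1, h2, h3, h4, h5, rfl⟩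
  | succ p ih =>
    rintro x z w c ⟨c', z', g1, g2, g3, g4, g5, hw⟩ h1 h2 h3 h4 h5
    exact ⟨c', z', g1, g2, g3, g4, g5, ih hw h1 h2 h3 h4 h5⟩

-- The induction step on the ground set: once the signs are trivial inside `T`, a choice of element
-- signs makes them constant inside `insert j T`. By `eq_of_exch_eq` only the single exchanges at
-- `B₀` have to be corrected.
open Classical in
theorem exists_gauge_insert (h : SignsCompatible 𝔅 f) {T B₀ : Finset E} {j : E} (hjT : j ∉ T)
    (hB₀ : 𝔅 B₀) (hB₀T : B₀ ⊆ T) (hT : ∀ B, 𝔅 B → B ⊆ T → f B = 1) :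
    ∃ t : E → ℤˣ, ∀ B, 𝔅 B → B ⊆ insert j T → f B * ∏ i ∈ B, t i = f B₀ * ∏ i ∈ B₀, t i := by
  have hjB : j ∉ B₀ := fun hj => hjT (hB₀T hj)
  let R : E → Prop := fun x => ∃ p y, y ∈ B₀ ∧ 𝔅 (exch B₀ y j) ∧ f (exch B₀ y j) = -1 ∧
    ExchWalk 𝔅 T B₀ p y x
  -- `R` collects the components containing some `y` for which exchanging `y` for `j` has sign `-1`.
  -- The sign flips on these elements of `B₀` and on the elements of `T \ B₀` joined to them; the
  -- two flips cancel on exchanges inside `T`, while only the first acts on exchanges for `j`.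
  let t : E → ℤˣ := fun x =>
    if x ∈ B₀ then if R x then -1 else 1
    else if x ≠ j ∧ ∃ y ∈ B₀, 𝔅 (exch B₀ y x) ∧ R y then -1 else 1
  have htj : t j = 1 := by simp [t, hjB]
  have hgt := h.gauge 1 t
  refine ⟨t, fun B hB hBT => ?_⟩
  have hone : ∀ i ∈ B₀, ∀ c ∈ insert j T, c ∉ B₀ → 𝔅 (exch B₀ i c) →
      1 * f (exch B₀ i c) * ∏ x ∈ exch B₀ i c, t x = 1 * f B₀ * ∏ x ∈ B₀, t x := by
    intro i hi c hc hcB hb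
    rw [exch, prod_insert (by simp [hcB]), ← mul_prod_erase B₀ t hi, ← exch, one_mul, one_mul,
      ← mul_assoc, ← mul_assoc]
    congr 1
    rw [hT B₀ hB₀ hB₀T, one_mul]
    rcases eq_or_ne c j with rfl | hcj
    · rw [htj, mul_one]
      have hti : t i = if R i then -1 else 1 := by simp [t, hi]
      rw [hti]
      split_ifs with hR
      · obtain ⟨p, y, hy, hyj, hfy, hw⟩ := hR
        rw [← h.exch_eq_of_exchWalk hjT hT p B₀ y i hB₀ hB₀T hy hi hyj hb hw, hfy]
      · rcases Int.units_eq_one_or (f (exch B₀ i c)) with hf | hf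
        · exact hf
        · exact absurd ⟨0, i, hi, hb, hf, rfl⟩ hR
    · have hcT : c ∈ T := (mem_insert.1 hc).resolve_left hcj
      rw [hT _ hb (exch_subset hB₀T hcT), one_mul]
      have hti : t i = if R i then -1 else 1 := by simp [t, hi]
      have htc : t c = if ∃ y ∈ B₀, 𝔅 (exch B₀ y c) ∧ R y then -1 else 1 := by
        simp [t, hcB, hcj]
      have : (∃ y ∈ B₀, 𝔅 (exch B₀ y c) ∧ R y) ↔ R i := by
        constructor
        · rintro ⟨y, hy, hyc, p, z, hz, hzj, hfz, hw⟩
          exact ⟨p + 1, z, hz, hzj, hfz, exchWalk_snoc p hw hcT hcB hi hyc hb⟩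
        · exact fun hR => ⟨i, hi, hb, hR⟩
      rw [hti, htc]
      simp only [this]
  have := hgt.eq_of_exch_eq (T := insert j T) _ B₀ B hB₀ hB (hB₀T.trans (subset_insert _ _)) hBT
    rfl hone
  simpa using this

/-- Compatible signs on the bases are, up to a global sign, products of signs of the elements. -/
theorem exists_prod_eq [Fintype E] (h : SignsCompatible 𝔅 f) {B₀ : Finset E} (hB₀ : 𝔅 B₀) :
    ∃ (e : ℤˣ) (s : E → ℤˣ), ∀ B, 𝔅 B → f B = e * ∏ i ∈ B, s i := by
  have key : ∀ S : Finset E, ∃ (e : ℤˣ) (s : E → ℤˣ), ∀ B, 𝔅 B → B ⊆ B₀ ∪ S →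
      e * f B * ∏ i ∈ B, s i = 1 := by
    intro S
    induction S using Finset.induction_on with
    | empty =>
      refine ⟨f B₀, 1, fun B hB hBS => ?_⟩
      have : B = B₀ := by
        rw [union_empty] at hBS
        by_contra hne
        obtain ⟨c, hc, hc'⟩ := exists_of_ssubset (hBS.ssubset_of_ne hne)
        obtain ⟨x, hx, hx', -⟩ := h.exchange B B₀ hB hB₀ c hc hc'
        exact hx' (hBS hx)
      simp [this]
    | insert j S hj ih =>
      obtain ⟨e, s, hs⟩ := ih
      by_cases hjT : j ∈ B₀ ∪ S
      · refine ⟨e, s, fun B hB hBS => hs B hB (hBS.trans ?_)⟩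
        rw [union_insert, insert_eq_self.2 hjT]
      · obtain ⟨t, ht⟩ := (h.gauge e s).exists_gauge_insert hjT hB₀ subset_union_left hs
        have h1 := hs B₀ hB₀ subset_union_left
        refine ⟨e * ∏ i ∈ B₀, t i, fun i => s i * t i, fun B hB hBS => ?_⟩
        have := ht B hB (by rwa [union_insert] at hBS)
        rw [h1, one_mul] at this
        rw [prod_mul_distrib]
        calc _ = (e * f B * (∏ i ∈ B, s i) * ∏ i ∈ B, t i) * ∏ i ∈ B₀, t i := by
              simp only [mul_comm, mul_left_comm]
          _ = 1 := by rw [this, Int.units_mul_self]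
  obtain ⟨e, s, hs⟩ := key univ
  refine ⟨e, s, fun B hB => ?_⟩
  have := hs B hB ((subset_univ B).trans subset_union_right)
  calc f B = (e * e) * f B * ((∏ i ∈ B, s i) * ∏ i ∈ B, s i) := by
          rw [Int.units_mul_self, Int.units_mul_self, one_mul, mul_one]
    _ = e * (e * f B * ∏ i ∈ B, s i) * ∏ i ∈ B, s i := by
          simp only [mul_comm, mul_left_comm]
    _ = _ := by rw [this, mul_one]

end SignsCompatible

end Exchange

/-! ### Alternants, power sums and the Schur functions of shape at most `(2, 2)`. -/

section Alternant

variable {R : Type*} [CommRing R]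

/-- By Cramer's rule the right side is the trace of `A.adjugate * (D * A)`, and the trace is cyclic.
-/
theorem trace_mul_det {ι : Type*} [Fintype ι] [DecidableEq ι] (D A : Matrix ι ι R) :
    D.trace * A.det = ∑ i, (A.updateCol i fun l => (D * A) l i).det := by
  have h : ∀ i, (A.updateCol i fun l => (D * A) l i).det = (A.adjugate * (D * A)) i i := by
    intro i
    rw [← Matrix.cramer_apply, Matrix.cramer_eq_adjugate_mulVec, Matrix.mul_apply]
    rfl
  simp_rw [h]
  change _ = (A.adjugate * (D * A)).trace
  rw [Matrix.trace_mul_comm, Matrix.mul_assoc, Matrix.mul_adjugate, Matrix.mul_smul, mul_one,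
    Matrix.trace_smul, smul_eq_mul, mul_comm]

/-- The alternant with nodes `x` and exponents `e`. -/
def alternant {k : ℕ} (x : Fin k → R) (e : Fin k → ℕ) : R :=
  (Matrix.of fun l i => x l ^ e i).det

theorem psum_mul_alternant {k : ℕ} (x : Fin k → R) (e : Fin k → ℕ) (r : ℕ) :
    (∑ l, x l ^ r) * alternant x e = ∑ i, alternant x (Function.update e i (e i + r)) := by
  have := trace_mul_det (Matrix.diagonal fun l => x l ^ r) (Matrix.of fun l i => x l ^ e i)
  rw [Matrix.trace_diagonal] at this
  rw [alternant, this]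
  refine sum_congr rfl fun i _ => ?_
  rw [alternant]
  congr 1
  ext l j
  rcases eq_or_ne j i with rfl | hj
  · simp [pow_add, mul_comm]
  · simp [hj]

theorem alternant_eq_zero {k : ℕ} (x : Fin k → R) {e : Fin k → ℕ} {i j : Fin k} (hij : i ≠ j)
    (h : e i = e j) : alternant x e = 0 :=
  Matrix.det_zero_of_column_eq hij fun l => by simp [h]

theorem alternant_comp_swap {k : ℕ} (x : Fin k → R) (e : Fin k → ℕ) {i j : Fin k} (hij : i ≠ j) :
    alternant x (e ∘ Equiv.swap i j) = -alternant x e := by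
  refine (Matrix.det_permute' (Equiv.swap i j) (Matrix.of fun l i => x l ^ e i)).trans ?_
  simp [alternant, Equiv.Perm.sign_swap hij]

variable {m : ℕ} (x : Fin (m + 2) → R)

/-- The alternant whose last two exponents are `u` and `v`. -/
def alternantSnoc (c : Fin m → ℕ) (u v : ℕ) : R :=
  alternant x (Fin.snoc (α := fun _ => ℕ) (Fin.snoc (α := fun _ => ℕ) c u) v)

theorem alternantSnoc_self (c : Fin m → ℕ) (u : ℕ) : alternantSnoc x c u u = 0 :=
  alternant_eq_zero x (i := (Fin.last m).castSucc) (j := Fin.last (m + 1))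
    (Fin.castSucc_lt_last _).ne (by simp)

theorem alternantSnoc_swap (c : Fin m → ℕ) (u v : ℕ) :
    alternantSnoc x c u v = -alternantSnoc x c v u := by
  rw [alternantSnoc, alternantSnoc,
    ← alternant_comp_swap x _ (i := (Fin.last m).castSucc) (j := Fin.last (m + 1))
    (Fin.castSucc_lt_last _).ne]
  congr 1
  funext i
  refine Fin.lastCases ?_ (fun i => Fin.lastCases ?_ (fun i => ?_) i) i
  · simp
  · simp
  · have h1 : i.castSucc.castSucc ≠ (Fin.last m).castSucc :=
      fun h => (Fin.castSucc_lt_last i).ne (Fin.castSucc_injective _ h)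
    have h2 : i.castSucc.castSucc ≠ Fin.last (m + 1) := (Fin.castSucc_lt_last _).ne
    simp [Equiv.swap_apply_of_ne_of_ne h1 h2]

theorem alternantSnoc_eq_zero (c : Fin m → ℕ) (u v : ℕ) (i : Fin m) (h : c i = u) :
    alternantSnoc x c u v = 0 :=
  alternant_eq_zero x (i := i.castSucc.castSucc) (j := (Fin.last m).castSucc)
    (fun h => (Fin.castSucc_lt_last i).ne (Fin.castSucc_injective _ h)) (by simp [h])

theorem alternantSnoc_eq_zero' (c : Fin m → ℕ) (u v : ℕ) {i j : Fin m} (hij : i ≠ j)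
    (h : c i = c j) : alternantSnoc x c u v = 0 :=
  alternant_eq_zero x (i := i.castSucc.castSucc) (j := j.castSucc.castSucc)
    (by simpa using hij) (by simp [h])

theorem alternantSnoc_update_swap (c : Fin m → ℕ) (i : Fin m) (p q v : ℕ) :
    alternantSnoc x (Function.update c i p) q v = -alternantSnoc x (Function.update c i q) p v := by
  have h1 : i.castSucc.castSucc ≠ (Fin.last m).castSucc :=
      fun h => (Fin.castSucc_lt_last i).ne (Fin.castSucc_injective _ h)
  have h2 : i.castSucc.castSucc ≠ Fin.last (m + 1) := (Fin.castSucc_lt_last _).ne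
  rw [alternantSnoc, alternantSnoc, ← alternant_comp_swap x _ h1]
  congr 1
  funext j
  refine Fin.lastCases ?_ (fun j => Fin.lastCases ?_ (fun j => ?_) j) j
  · simp [Fin.snoc_update, h2.symm,
      Equiv.swap_apply_of_ne_of_ne h2.symm (Fin.castSucc_lt_last (Fin.last m)).ne']
  · simp [Fin.snoc_update, (Fin.castSucc_lt_last i).ne']
  · rcases eq_or_ne j i with rfl | hj
    · simp [Fin.snoc_update, h1.symm]
    · have h3 : j.castSucc.castSucc ≠ (Fin.last m).castSucc :=
        fun h => (Fin.castSucc_lt_last j).ne (Fin.castSucc_injective _ h)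
      have h4 : j.castSucc.castSucc ≠ i.castSucc.castSucc := by simpa using hj
      simp [Equiv.swap_apply_of_ne_of_ne h4 h3, hj]

theorem psum_mul_alternantSnoc (c : Fin m → ℕ) (u v r : ℕ) :
    (∑ l, x l ^ r) * alternantSnoc x c u v =
      ∑ i, alternantSnoc x (Function.update c i (c i + r)) u v
        + alternantSnoc x c (u + r) v + alternantSnoc x c u (v + r) := by
  rw [alternantSnoc, psum_mul_alternant, Fin.sum_univ_castSucc, Fin.sum_univ_castSucc]
  simp only [alternantSnoc, Fin.snoc_castSucc, Fin.snoc_last, ← Fin.snoc_update,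
    Fin.update_snoc_last]

/-- The alternant with exponents `0, …, m - 1, m + a, m + b`. -/
def bialternant (a b : ℕ) : R := alternantSnoc x (fun i => (i : ℕ)) (m + a) (m + b)

/-- The contribution of the first `m` columns to the product of `bialternant x a b` with the
`r`-th power sum. -/
def headShift (r a b : ℕ) : R :=
  ∑ i : Fin m, alternantSnoc x (Function.update (fun i => (i : ℕ)) i ((i : ℕ) + r)) (m + a) (m + b)

theorem psum_mul_bialternant (r a b : ℕ) :
    (∑ l, x l ^ r) * bialternant x a b =
      headShift x r a b + bialternant x (a + r) b + bialternant x a (b + r) := by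
  rw [bialternant, psum_mul_alternantSnoc]
  simp only [bialternant, headShift, add_assoc]

theorem bialternant_self (a : ℕ) : bialternant x a a = 0 := alternantSnoc_self x _ _

theorem bialternant_swap (a b : ℕ) : bialternant x a b = -bialternant x b a :=
  alternantSnoc_swap x _ _ _

theorem headShift_self (r a : ℕ) : headShift x r a a = 0 :=
  sum_eq_zero fun _ _ => alternantSnoc_self x _ _

theorem headShift_swap (r a b : ℕ) : headShift x r a b = -headShift x r b a := by
  rw [headShift, headShift, ← sum_neg_distrib]
  exact sum_congr rfl fun _ _ => alternantSnoc_swap x _ _ _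

theorem alternantSnoc_update_eq_zero (i : Fin m) {p : ℕ} (hp : p < m) (hpi : p ≠ i) (q v : ℕ) :
    alternantSnoc x (Function.update (fun i => (i : ℕ)) i p) q v = 0 := by
  have hne : (⟨p, hp⟩ : Fin m) ≠ i := fun h => hpi (congrArg Fin.val h)
  exact alternantSnoc_eq_zero' x _ _ _ hne (by simp [hne])

theorem alternantSnoc_update_self (i : Fin m) (p v : ℕ) :
    alternantSnoc x (Function.update (fun i => (i : ℕ)) i p) p v = 0 :=
  alternantSnoc_eq_zero x _ _ _ i (by simp)

theorem headShift_one_zero (b : ℕ) : headShift x 1 0 b = 0 := by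
  refine sum_eq_zero fun i _ => ?_
  by_cases h : (i : ℕ) + 1 < m
  · exact alternantSnoc_update_eq_zero x i h (by omega) _ _
  · rw [show (i : ℕ) + 1 = m + 0 by omega, alternantSnoc_update_self]

/-- A shifted exponent below `m` repeats another column, as does one equal to the next-to-last
exponent. The only survivors come from the last head column and differ by interchanging `m` and `m +
1`. The case of total shift three works in the same way. -/
theorem headShift_two_zero (b : ℕ) : headShift x 2 0 b + headShift x 1 1 b = 0 := by
  rw [headShift, headShift, ← sum_add_distrib]
  refine sum_eq_zero fun i _ => ?_
  by_cases h : (i : ℕ) + 1 < m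
  · rw [alternantSnoc_update_eq_zero x i h (by omega)]
    by_cases h' : (i : ℕ) + 2 < m
    · rw [alternantSnoc_update_eq_zero x i h' (by omega), zero_add]
    · rw [show (i : ℕ) + 2 = m + 0 by omega, alternantSnoc_update_self, zero_add]
  · rw [show (i : ℕ) + 2 = m + 1 by omega, show (i : ℕ) + 1 = m + 0 by omega,
      alternantSnoc_update_swap, neg_add_cancel]

theorem headShift_three_zero (b : ℕ) :
    headShift x 3 0 b + headShift x 2 1 b + headShift x 1 2 b = 0 := by
  rw [headShift, headShift, headShift, ← sum_add_distrib, ← sum_add_distrib]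
  refine sum_eq_zero fun i _ => ?_
  by_cases h : (i : ℕ) + 1 < m
  · rw [alternantSnoc_update_eq_zero x i h (by omega), add_zero]
    by_cases h' : (i : ℕ) + 2 < m
    · rw [alternantSnoc_update_eq_zero x i h' (by omega), add_zero]
      by_cases h'' : (i : ℕ) + 3 < m
      · rw [alternantSnoc_update_eq_zero x i h'' (by omega)]
      · rw [show (i : ℕ) + 3 = m + 0 by omega, alternantSnoc_update_self]
    · rw [show (i : ℕ) + 3 = m + 1 by omega, show (i : ℕ) + 2 = m + 0 by omega,
        alternantSnoc_update_swap, neg_add_cancel]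
  · rw [show (i : ℕ) + 3 = m + 2 by omega, show (i : ℕ) + 2 = m + 1 by omega,
      show (i : ℕ) + 1 = m + 0 by omega, alternantSnoc_update_swap,
      alternantSnoc_update_self]
    ring

theorem psum_one_mul : (∑ l, x l ^ 1) * bialternant x 0 1 = bialternant x 0 2 := by
  rw [psum_mul_bialternant, headShift_one_zero, bialternant_self]; ring

theorem psum_one_sq_mul : (∑ l, x l ^ 1) ^ 2 * bialternant x 0 1 =
    bialternant x 1 2 + bialternant x 0 3 := by
  rw [sq, mul_assoc, psum_one_mul, psum_mul_bialternant, headShift_one_zero, zero_add]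

theorem psum_two_mul : (∑ l, x l ^ 2) * bialternant x 0 1 =
    bialternant x 0 3 - bialternant x 1 2 := by
  have h := headShift_two_zero x 1
  rw [headShift_self] at h
  rw [psum_mul_bialternant, bialternant_swap x (0 + 2) 1]
  linear_combination h

theorem psum_one_cube_sub_psum_three_mul :
    ((∑ l, x l ^ 1) ^ 3 - ∑ l, x l ^ 3) * bialternant x 0 1 = 3 * bialternant x 1 3 := by
  have h := headShift_three_zero x 1
  rw [headShift_self, headShift_swap x 1 2 1] at h
  have h1 := psum_one_sq_mul x
  have h2 := psum_mul_bialternant x 3 0 1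
  have h3 := psum_mul_bialternant x 1 1 2
  have h4 := psum_mul_bialternant x 1 0 3
  norm_num only at h2 h3 h4
  rw [bialternant_self] at h3
  rw [headShift_one_zero] at h4
  rw [bialternant_swap x 3 1] at h2
  linear_combination (∑ l, x l ^ 1) * h1 - h2 + h3 + h4 - h

/-- Divided by the Vandermonde determinant `bialternant x 0 1`, the alternant `bialternant x a b` is
the Schur function of shape `(b - 1, a)`; this is `p₁⁴ - 4p₁p₃ + 3p₂² = 12 s₂₂`. -/
theorem kpPoly_mul_bialternant :
    ((∑ l, x l ^ 1) ^ 4 - 4 * (∑ l, x l ^ 1) * (∑ l, x l ^ 3) + 3 * (∑ l, x l ^ 2) ^ 2)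
      * bialternant x 0 1 = 12 * bialternant x 2 3 := by
  have a := psum_one_cube_sub_psum_three_mul x
  have b := psum_one_mul x
  have c := psum_two_mul x
  have h1 := psum_mul_bialternant x 1 1 3
  have h2 := psum_mul_bialternant x 3 0 2
  have h3 := psum_mul_bialternant x 2 0 3
  have h4 := psum_mul_bialternant x 2 1 2
  norm_num only at h1 h2 h3 h4
  rw [bialternant_swap x 3 2] at h2 h4
  have k1 := headShift_three_zero x 2
  rw [headShift_self] at k1
  have k2 := headShift_two_zero x 3
  linear_combination (∑ l, x l ^ 1) * a - 3 * (∑ l, x l ^ 3) * b + 3 * (∑ l, x l ^ 2) * c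
    + 3 * h1 - 3 * h2 + 3 * h3 - 3 * h4 - 3 * k1 + 3 * k2

end Alternant

/-! ### The three-term Plücker relation. -/

section Pluecker

variable {R : Type*} [CommRing R]

/-- The determinant whose last two columns are `a` and `b`. -/
def detSnoc {m : ℕ} (c : Fin m → Fin (m + 2) → R) (a b : Fin (m + 2) → R) : R :=
  (Matrix.of fun l i => Fin.snoc (α := fun _ => Fin (m + 2) → R)
    (Fin.snoc (α := fun _ => Fin (m + 2) → R) c a) b i l).det

theorem detSnoc_pluecker {m : ℕ} (c : Fin m → Fin (m + 2) → R) (a b u v : Fin (m + 2) → R) :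
    detSnoc c a b * detSnoc c u v = detSnoc c u b * detSnoc c a v + detSnoc c a u * detSnoc c b v := by
  have cr : ∀ a b y, Matrix.cramer (Matrix.of fun l i => Fin.snoc (α := fun _ => Fin (m + 2) → R)
      (Fin.snoc (α := fun _ => Fin (m + 2) → R) c a) b i l) y (Fin.last m).castSucc
        = detSnoc c y b := by
    intro a b y
    rw [Matrix.cramer_apply, detSnoc]
    congr 1
    ext l i
    refine Fin.lastCases ?_ (fun i => Fin.lastCases ?_ (fun i => ?_) i) i
    · simp [(Fin.castSucc_lt_last (Fin.last m)).ne']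
    · simp
    · simp [(Fin.castSucc_lt_last i).ne]
  have cr' : ∀ a b y, Matrix.cramer (Matrix.of fun l i => Fin.snoc (α := fun _ => Fin (m + 2) → R)
      (Fin.snoc (α := fun _ => Fin (m + 2) → R) c a) b i l) y (Fin.last (m + 1))
        = detSnoc c a y := by
    intro a b y
    rw [Matrix.cramer_apply, detSnoc]
    congr 1
    ext l i
    refine Fin.lastCases ?_ (fun i => ?_) i
    · simp
    · simp [(Fin.castSucc_lt_last i).ne]
  set A : Matrix (Fin (m + 2)) (Fin (m + 2)) R := Matrix.of fun l i =>
    Fin.snoc (α := fun _ => Fin (m + 2) → R)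
      (Fin.snoc (α := fun _ => Fin (m + 2) → R) c a) b i l with hA
  have key := Matrix.mulVec_cramer A u
  have hsum : A.det • u = ∑ i, A.cramer u i • fun l => A l i := by
    rw [← key]
    ext l
    simp [Matrix.mulVec, dotProduct, mul_comm]
  have h0 : ∀ i : Fin m, detSnoc c (c i) v = 0 := by
    intro i
    refine Matrix.det_zero_of_column_eq (i := i.castSucc.castSucc) (j := (Fin.last m).castSucc)
      (fun h => (Fin.castSucc_lt_last i).ne (Fin.castSucc_injective _ h)) fun l => by simp
  set M : Matrix (Fin (m + 2)) (Fin (m + 2)) R := Matrix.of fun l i =>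
    Fin.snoc (α := fun _ => Fin (m + 2) → R)
      (Fin.snoc (α := fun _ => Fin (m + 2) → R) c u) v i l with hM
  have hMy : ∀ y, M.cramer y (Fin.last m).castSucc = detSnoc c y v := cr u v
  -- Expand `u` in the columns of `A` by Cramer's rule and insert the result in the next-to-last
  -- slot: the columns in `c` repeat, and only `a` and `b` contribute.
  have : A.det * detSnoc c u v = M.cramer (A.det • u) (Fin.last m).castSucc := by
    rw [map_smul, Pi.smul_apply, hMy, smul_eq_mul]
  rw [hsum, map_sum, Finset.sum_apply] at this
  simp_rw [map_smul, Pi.smul_apply, hMy, smul_eq_mul] at this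
  rw [Fin.sum_univ_castSucc, Fin.sum_univ_castSucc, cr a b u, cr' a b u] at this
  simp only [hA, Matrix.of_apply, Fin.snoc_castSucc, Fin.snoc_last, h0, mul_zero, sum_const_zero,
    zero_add] at this
  exact this

end Pluecker

/-! ### The Cauchy–Binet formula. -/

section CauchyBinet

variable {R : Type*} [CommRing R] {n k : ℕ}

theorem det_mul_eq_sum_prod_mul_det (M : Matrix (Fin k) (Fin n) R) (K : Matrix (Fin n) (Fin k) R) :
    (M * K).det = ∑ a : Fin k → Fin n, (∏ i, K (a i) i) * (M.submatrix id a).det := by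
  have h : (M * K).transpose = fun i => ∑ α, K α i • fun l => M l α := by
    ext i l
    simp [Matrix.mul_apply, mul_comm]
  rw [← Matrix.det_transpose, h]
  refine ((Matrix.detRowAlternating (n := Fin k) (R := R)).toMultilinearMap.map_sum
    (fun i α => K α i • fun l => M l α)).trans (sum_congr rfl fun a _ => ?_)
  refine ((Matrix.detRowAlternating (n := Fin k) (R := R)).toMultilinearMap.map_smul_univ
    (fun i => K (a i) i) (fun i l => M l (a i))).trans ?_
  rw [smul_eq_mul, ← Matrix.det_transpose]
  rfl

/-- The Cauchy–Binet formula. -/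
theorem det_mul_eq_sum_minors (M : Matrix (Fin k) (Fin n) R) (K : Matrix (Fin n) (Fin k) R) :
    (M * K).det = ∑ I : KSubset n k, (M.submatrix id (I.1.orderEmbOfFin I.2)).det *
      (K.submatrix (I.1.orderEmbOfFin I.2) id).det := by
  have hI : ∀ I : KSubset n k, (M.submatrix id (I.1.orderEmbOfFin I.2)).det *
      (K.submatrix (I.1.orderEmbOfFin I.2) id).det = ∑ σ : Equiv.Perm (Fin k),
        (∏ i, K (I.1.orderEmbOfFin I.2 (σ i)) i) *
          (M.submatrix id (I.1.orderEmbOfFin I.2 ∘ σ)).det := by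
    intro I
    rw [Matrix.det_apply' (K.submatrix _ id), mul_sum]
    refine sum_congr rfl fun σ _ => ?_
    have := Matrix.det_permute' σ (M.submatrix id (I.1.orderEmbOfFin I.2))
    rw [Matrix.submatrix_submatrix] at this
    change (M.submatrix id _).det = _ at this
    rw [this]
    simp only [Matrix.submatrix_apply, id]
    ring
  rw [det_mul_eq_sum_prod_mul_det, sum_congr rfl fun I _ => hI I, ← Finset.sum_product',
    ← sum_filter_add_sum_filter_not univ (fun a : Fin k → Fin n => Function.Injective a)]
  rw [sum_eq_zero (s := univ.filter fun a : Fin k → Fin n => ¬ Function.Injective a), add_zero]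
  · symm
    refine sum_bij (fun p _ => p.1.1.orderEmbOfFin p.1.2 ∘ p.2) ?_ ?_ ?_ ?_
    · intro p _
      simpa using (p.1.1.orderEmbOfFin p.1.2).injective
    · rintro ⟨I, σ⟩ _ ⟨J, ρ⟩ _ h
      have hIJ : I = J := by
        have := congrArg Set.range h
        rw [Set.range_comp, Set.range_comp, σ.surjective.range_eq, ρ.surjective.range_eq,
          Set.image_univ, Set.image_univ, range_orderEmbOfFin, range_orderEmbOfFin] at this
        exact Subtype.ext (by exact_mod_cast this)
      subst hIJ
      congr 1
      ext i
      have := (I.1.orderEmbOfFin I.2).injective (congrFun h i)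
      exact congrArg Fin.val this
    · intro a ha
      have ha : Function.Injective a := (mem_filter.1 ha).2
      have hc : #(univ.image a) = k := by rw [card_image_of_injective _ ha]; simp
      let e := (univ.image a).orderIsoOfFin hc
      let g : Fin k → Fin k := fun i => e.symm ⟨a i, mem_image_of_mem a (mem_univ i)⟩
      have hg : Function.Injective g := by
        intro i j hij
        have := e.symm.injective hij
        exact ha (congrArg Subtype.val this)
      refine ⟨(⟨univ.image a, hc⟩, Equiv.ofBijective g (Finite.injective_iff_bijective.1 hg)),
        by simp, ?_⟩
      funext i
      change ((univ.image a).orderEmbOfFin hc) (g i) = a i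
      rw [← coe_orderIsoOfFin_apply]
      simp [g, e]
    · intro p _
      rfl
  · intro a ha
    have ha := (mem_filter.1 ha).2
    simp only [Function.Injective, not_forall] at ha
    obtain ⟨i, j, hij, hne⟩ := ha
    rw [Matrix.det_zero_of_column_eq hne fun l => by simp [hij], mul_zero]

end CauchyBinet

/-! ### The bilinear identity for the minors, from the Plücker relation. -/

section Bilinear

variable {n k : ℕ}

/-- The power sum of the parameters indexed by `I`. -/
def psumOn (κ : Fin n → ℝ) (I : Finset (Fin n)) (r : ℕ) : ℝ := ∑ α ∈ I, κ α ^ r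

/-- The symbol of the bilinear KP operator on a pair of exponentials. -/
def kpSymbol (κ : Fin n → ℝ) (I J : Finset (Fin n)) : ℝ :=
  (psumOn κ I 1 - psumOn κ J 1) ^ 4
    - 4 * (psumOn κ I 1 - psumOn κ J 1) * (psumOn κ I 3 - psumOn κ J 3)
    + 3 * (psumOn κ I 2 - psumOn κ J 2) ^ 2

theorem psumOn_eq (κ : Fin n → ℝ) (I : KSubset n k) (r : ℕ) :
    psumOn κ I.1 r = ∑ l, (κ ∘ I.1.orderEmbOfFin I.2) l ^ r := by
  rw [psumOn]
  conv_lhs => rw [← map_orderEmbOfFin_univ I.1 I.2]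
  rw [sum_map]
  rfl

theorem sum_colMinor_mul_alternant (κ : Fin n → ℝ) (M : Matrix (Fin k) (Fin n) ℝ)
    (e : Fin k → ℕ) :
    ∑ I : KSubset n k, colMinor M I * alternant (κ ∘ I.1.orderEmbOfFin I.2) e =
      (Matrix.of fun l i => ∑ α, M l α * κ α ^ e i).det := by
  have := det_mul_eq_sum_minors M (Matrix.of fun α i => κ α ^ e i)
  rw [show (Matrix.of fun l i => ∑ α, M l α * κ α ^ e i) =
    M * (Matrix.of fun α i => κ α ^ e i) by ext l i; simp [Matrix.mul_apply], this]
  rfl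

theorem snoc_val_val (m : ℕ) : (Fin.snoc (α := fun _ => ℕ) (Fin.snoc (α := fun _ => ℕ)
    (fun i : Fin m => (i : ℕ)) (m + 0)) (m + 1) : Fin (m + 2) → ℕ) = fun i : Fin (m + 2) => (i : ℕ) := by
  funext i
  refine Fin.lastCases ?_ (fun i => Fin.lastCases ?_ (fun i => ?_) i) i <;> simp

theorem vdmMinor_eq_bialternant {m : ℕ} (κ : Fin n → ℝ) (I : KSubset n (m + 2)) :
    vdmMinor κ I = bialternant (κ ∘ I.1.orderEmbOfFin I.2) 0 1 := by
  rw [bialternant, alternantSnoc, snoc_val_val]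
  rfl

/-- The symbol is the KP polynomial in differences of power sums; expanded in Schur functions of `I`
and `J` it becomes the polarised Plücker relation. -/
theorem kpSymbol_mul_vdmMinor {m : ℕ} (κ : Fin n → ℝ) (I J : KSubset n (m + 2)) :
    vdmMinor κ I * vdmMinor κ J * kpSymbol κ I.1 J.1 =
      12 * (bialternant (κ ∘ I.1.orderEmbOfFin I.2) 2 3 * bialternant (κ ∘ J.1.orderEmbOfFin J.2) 0 1
        + bialternant (κ ∘ I.1.orderEmbOfFin I.2) 0 1 * bialternant (κ ∘ J.1.orderEmbOfFin J.2) 2 3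
        - bialternant (κ ∘ I.1.orderEmbOfFin I.2) 1 3 * bialternant (κ ∘ J.1.orderEmbOfFin J.2) 0 2
        - bialternant (κ ∘ I.1.orderEmbOfFin I.2) 0 2 * bialternant (κ ∘ J.1.orderEmbOfFin J.2) 1 3
        + bialternant (κ ∘ I.1.orderEmbOfFin I.2) 1 2 * bialternant (κ ∘ J.1.orderEmbOfFin J.2) 0 3
        + bialternant (κ ∘ I.1.orderEmbOfFin I.2) 0 3 *
          bialternant (κ ∘ J.1.orderEmbOfFin J.2) 1 2) := by
  rw [vdmMinor_eq_bialternant, vdmMinor_eq_bialternant, kpSymbol]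
  simp only [psumOn_eq]
  generalize κ ∘ I.1.orderEmbOfFin I.2 = x
  generalize κ ∘ J.1.orderEmbOfFin J.2 = y
  have x1 := psum_one_mul x
  have x2 := psum_one_sq_mul x
  have x3 := psum_two_mul x
  have x4 := psum_one_cube_sub_psum_three_mul x
  have x5 := kpPoly_mul_bialternant x
  have y1 := psum_one_mul y
  have y2 := psum_one_sq_mul y
  have y3 := psum_two_mul y
  have y4 := psum_one_cube_sub_psum_three_mul y
  have y5 := kpPoly_mul_bialternant y
  generalize (∑ l, x l ^ 1) = p1 at *
  generalize (∑ l, x l ^ 2) = p2 at *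
  generalize (∑ l, x l ^ 3) = p3 at *
  generalize (∑ l, y l ^ 1) = q1 at *
  generalize (∑ l, y l ^ 2) = q2 at *
  generalize (∑ l, y l ^ 3) = q3 at *
  linear_combination bialternant y 0 1 * x5 + bialternant x 0 1 * y5
    - 4 * (q1 * bialternant y 0 1 * x4 + 3 * bialternant x 1 3 * y1)
    - 4 * (p1 * bialternant x 0 1 * y4 + 3 * bialternant y 1 3 * x1)
    + 6 * (q1 ^ 2 * bialternant y 0 1 * x2 + (bialternant x 1 2 + bialternant x 0 3) * y2)
    - 6 * (q2 * bialternant y 0 1 * x3 + (bialternant x 0 3 - bialternant x 1 2) * y3)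

/-- The bilinear relation behind the KP equation for `τ`-functions. -/
theorem sum_kpSymbol_eq_zero (κ : Fin n → ℝ) (M : Matrix (Fin k) (Fin n) ℝ) :
    ∑ I : KSubset n k, ∑ J : KSubset n k,
      colMinor M I * vdmMinor κ I * (colMinor M J * vdmMinor κ J) * kpSymbol κ I.1 J.1 = 0 := by
  match k, M with
  | 0, M =>
    refine sum_eq_zero fun I _ => sum_eq_zero fun J _ => ?_
    rw [kpSymbol, card_eq_zero.1 I.2, card_eq_zero.1 J.2]
    ring
  | 1, M =>
    refine sum_eq_zero fun I _ => sum_eq_zero fun J _ => ?_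
    obtain ⟨a, ha⟩ := card_eq_one.1 I.2
    obtain ⟨b, hb⟩ := card_eq_one.1 J.2
    rw [kpSymbol, ha, hb]
    simp only [psumOn, sum_singleton]
    ring
  | m + 2, M =>
    let v : ℕ → Fin (m + 2) → ℝ := fun j l => ∑ α, M l α * κ α ^ j
    let w : ℕ → ℕ → ℝ := fun a b => detSnoc (fun i : Fin m => v i) (v (m + a)) (v (m + b))
    have hw : ∀ a b, ∑ I : KSubset n (m + 2),
        colMinor M I * bialternant (κ ∘ I.1.orderEmbOfFin I.2) a b = w a b := by
      intro a b
      simp only [bialternant, alternantSnoc]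
      rw [sum_colMinor_mul_alternant]
      simp only [w, detSnoc]
      congr 1
      ext l i
      refine Fin.lastCases ?_ (fun i => Fin.lastCases ?_ (fun i => ?_) i) i <;> simp [v]
    have hpl : w 0 2 * w 1 3 = w 1 2 * w 0 3 + w 0 1 * w 2 3 := detSnoc_pluecker _ _ _ _ _
    have key : ∀ I J : KSubset n (m + 2),
        colMinor M I * vdmMinor κ I * (colMinor M J * vdmMinor κ J) * kpSymbol κ I.1 J.1 =
        12 * ((colMinor M I * bialternant (κ ∘ I.1.orderEmbOfFin I.2) 2 3) *
            (colMinor M J * bialternant (κ ∘ J.1.orderEmbOfFin J.2) 0 1)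
          + (colMinor M I * bialternant (κ ∘ I.1.orderEmbOfFin I.2) 0 1) *
            (colMinor M J * bialternant (κ ∘ J.1.orderEmbOfFin J.2) 2 3)
          - (colMinor M I * bialternant (κ ∘ I.1.orderEmbOfFin I.2) 1 3) *
            (colMinor M J * bialternant (κ ∘ J.1.orderEmbOfFin J.2) 0 2)
          - (colMinor M I * bialternant (κ ∘ I.1.orderEmbOfFin I.2) 0 2) *
            (colMinor M J * bialternant (κ ∘ J.1.orderEmbOfFin J.2) 1 3)
          + (colMinor M I * bialternant (κ ∘ I.1.orderEmbOfFin I.2) 1 2) *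
            (colMinor M J * bialternant (κ ∘ J.1.orderEmbOfFin J.2) 0 3)
          + (colMinor M I * bialternant (κ ∘ I.1.orderEmbOfFin I.2) 0 3) *
            (colMinor M J * bialternant (κ ∘ J.1.orderEmbOfFin J.2) 1 2)) := by
      intro I J
      linear_combination (colMinor M I * colMinor M J) * kpSymbol_mul_vdmMinor κ I J
    simp only [key, ← mul_sum, sum_add_distrib, sum_sub_distrib, ← sum_mul, hw]
    -- Each Plücker monomial occurs twice, with the roles of `I` and `J` interchanged, and the
    -- symbol contributes the factor 12.
    linear_combination -24 * hpl

end Bilinear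

/-! ### Hirota derivatives of exponential sums and independence of characters. -/

noncomputable section Hirota

variable {d : ℕ}

theorem hasLineDerivAt_exp_sum (u x : Fin d → ℝ) (i : Fin d) :
    HasLineDerivAt ℝ (fun x' : Fin d → ℝ => Real.exp (∑ r, u r * x' r))
      (u i * Real.exp (∑ r, u r * x r)) x (Pi.single i 1) := by
  have h : (fun t : ℝ => Real.exp (∑ r, u r * (x + t • (Pi.single i 1 : Fin d → ℝ)) r)) =
      fun t => Real.exp (∑ r, u r * x r + t * u i) := by
    funext t
    simp [mul_add, sum_add_distrib, Pi.single_apply, mul_comm]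
  rw [HasLineDerivAt, h]
  have := (((hasDerivAt_id (0 : ℝ)).mul_const (u i)).const_add (∑ r, u r * x r)).exp
  simpa [mul_comm] using this

theorem hirotaDiff_exp_sum {ι : Type*} (s : Finset ι) (c : ι → ℝ) (u w : ι → Fin d → ℝ)
    (i : Fin d) :
    hirotaDiff i (fun x y => ∑ t ∈ s, c t * (Real.exp (∑ r, u t r * x r) *
      Real.exp (∑ r, w t r * y r))) =
    fun x y => ∑ t ∈ s, ((u t i - w t i) * c t) * (Real.exp (∑ r, u t r * x r) *
      Real.exp (∑ r, w t r * y r)) := by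
  funext x y
  have h1 : HasLineDerivAt ℝ (fun x' : Fin d → ℝ => ∑ t ∈ s, c t * (Real.exp (∑ r, u t r * x' r) *
      Real.exp (∑ r, w t r * y r))) (∑ t ∈ s, c t * ((u t i * Real.exp (∑ r, u t r * x r)) *
      Real.exp (∑ r, w t r * y r))) x (Pi.single i 1) :=
    HasDerivAt.fun_sum fun t _ =>
      (HasDerivAt.mul_const (hasLineDerivAt_exp_sum (u t) x i) _).const_mul _
  have h2 : HasLineDerivAt ℝ (fun y' : Fin d → ℝ => ∑ t ∈ s, c t * (Real.exp (∑ r, u t r * x r) *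
      Real.exp (∑ r, w t r * y' r))) (∑ t ∈ s, c t * (Real.exp (∑ r, u t r * x r) *
      (w t i * Real.exp (∑ r, w t r * y r)))) y (Pi.single i 1) :=
    HasDerivAt.fun_sum fun t _ =>
      (HasDerivAt.const_mul _ (hasLineDerivAt_exp_sum (w t) y i)).const_mul _
  rw [hirotaDiff, h1.lineDeriv, h2.lineDeriv, ← sum_sub_distrib]
  exact sum_congr rfl fun t _ => by ring

variable {n : ℕ}

/-- The exponential sum with coefficients `C` over a family `𝒦` of subsets of the parameters. -/
def expSum (d : ℕ) (κ : Fin n → ℝ) (𝒦 : Finset (Finset (Fin n))) (C : Finset (Fin n) → ℝ)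
    (x : Fin d → ℝ) : ℝ :=
  ∑ I ∈ 𝒦, C I * Real.exp (∑ r : Fin d, psumOn κ I (r + 1) * x r)

theorem hirotaKP_expSum (hd : 3 ≤ d) (κ : Fin n → ℝ) (𝒦 : Finset (Finset (Fin n)))
    (C : Finset (Fin n) → ℝ) (x : Fin d → ℝ) :
    hirotaKP hd (expSum d κ 𝒦 C) (expSum d κ 𝒦 C) x =
      ∑ p ∈ 𝒦 ×ˢ 𝒦, C p.1 * C p.2 * kpSymbol κ p.1 p.2 *
        Real.exp (∑ r : Fin d, (psumOn κ p.1 (r + 1) + psumOn κ p.2 (r + 1)) * x r) := by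
  have hF : (fun u v : Fin d → ℝ => expSum d κ 𝒦 C u * expSum d κ 𝒦 C v) =
      fun u v => ∑ p ∈ 𝒦 ×ˢ 𝒦, (C p.1 * C p.2) *
        (Real.exp (∑ r : Fin d, psumOn κ p.1 (r + 1) * u r) *
          Real.exp (∑ r : Fin d, psumOn κ p.2 (r + 1) * v r)) := by
    funext u v
    rw [expSum, expSum, sum_mul_sum, ← sum_product']
    exact sum_congr rfl fun p _ => by ring
  have step := fun (c : Finset (Fin n) × Finset (Fin n) → ℝ) (i : Fin d) =>
    hirotaDiff_exp_sum (𝒦 ×ˢ 𝒦) c (fun p r => psumOn κ p.1 (r + 1))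
      (fun p r => psumOn κ p.2 (r + 1)) i
  simp only [hirotaKP, hF, Function.iterate_succ, Function.iterate_zero, Function.comp_apply, id,
    step]
  rw [mul_sum, mul_sum, ← sum_sub_distrib, ← sum_add_distrib]
  refine sum_congr rfl fun p _ => ?_
  simp only [add_mul, sum_add_distrib, Real.exp_add, kpSymbol, zero_add, Nat.reduceAdd]
  ring

/-- An exponential with linear exponent, as a character. -/
def expHom (u : Fin d → ℝ) : Multiplicative (Fin d → ℝ) →* ℝ where
  toFun x := Real.exp (∑ r, u r * x.toAdd r)
  map_one' := by simp
  map_mul' x y := by simp [mul_add, sum_add_distrib, Real.exp_add]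

theorem expHom_injective : Function.Injective (expHom (d := d)) := by
  intro u v h
  funext i
  have := DFunLike.congr_fun h (Multiplicative.ofAdd (Pi.single i 1))
  simpa [expHom, Pi.single_apply] using this

/-- Distinct characters are linearly independent; exponents may repeat among the indices, so only
the sums over equal exponents vanish. -/
theorem sum_filter_eq_zero_of_exp_sum {ι : Type*} (s : Finset ι) (c : ι → ℝ)
    (u : ι → Fin d → ℝ) (h : ∀ x : Fin d → ℝ, ∑ t ∈ s, c t * Real.exp (∑ r, u t r * x r) = 0)
    (u₀ : Fin d → ℝ) : ∑ t ∈ s with u t = u₀, c t = 0 := by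
  classical
  have hli := (linearIndependent_monoidHom (Multiplicative (Fin d → ℝ)) ℝ).comp _
    (expHom_injective (d := d))
  by_cases hu : u₀ ∈ s.image u
  · refine linearIndependent_iff'.1 hli (s.image u) (fun v => ∑ t ∈ s with u t = v, c t) ?_ u₀ hu
    funext x
    rw [Finset.sum_apply, Pi.zero_apply, ← h x.toAdd,
      ← sum_fiberwise_of_maps_to (t := s.image u) (g := u) fun t ht => mem_image_of_mem u ht]
    refine sum_congr rfl fun v _ => ?_
    rw [Pi.smul_apply, smul_eq_mul, sum_mul]
    refine sum_congr rfl fun t ht => ?_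
    rw [(mem_filter.1 ht).2]
    rfl
  · refine sum_eq_zero fun t ht => ?_
    obtain ⟨h1, h2⟩ := mem_filter.1 ht
    exact absurd (h2 ▸ mem_image_of_mem u h1) hu

end Hirota

/-! ### Separation of the equation by genericity. -/

section Coefficients

variable {n k d : ℕ}

theorem psumOn_union_inter (κ : Fin n → ℝ) (I J : Finset (Fin n)) (r : ℕ) :
    psumOn κ (I ∪ J) r + psumOn κ (I ∩ J) r = psumOn κ I r + psumOn κ J r :=
  sum_union_inter

/-- For generic parameters, the KP equation separates according to unions and intersections. -/
theorem IsGeneric.sum_kpSymbol_eq_zero {κ : Fin n → ℝ} (hκ : IsGeneric k d κ) (hd : 3 ≤ d)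
    (C : Finset (Fin n) → ℝ)
    (h : ∀ x : Fin d → ℝ, hirotaKP hd (expSum d κ (powersetCard k univ) C)
      (expSum d κ (powersetCard k univ) C) x = 0) {I J : Finset (Fin n)} (hI : #I = k)
    (hJ : #J = k) :
    ∑ p ∈ powersetCard k univ ×ˢ powersetCard k univ with
      p.1 ∪ p.2 = I ∪ J ∧ p.1 ∩ p.2 = I ∩ J, C p.1 * C p.2 * kpSymbol κ p.1 p.2 = 0 := by
  simp only [hirotaKP_expSum] at h
  have h0 := sum_filter_eq_zero_of_exp_sum (powersetCard k univ ×ˢ powersetCard k univ)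
    (fun p : Finset (Fin n) × Finset (Fin n) => C p.1 * C p.2 * kpSymbol κ p.1 p.2)
    (fun p (r : Fin d) => psumOn κ p.1 (r + 1) + psumOn κ p.2 (r + 1)) h
    (fun r : Fin d => psumOn κ I (r + 1) + psumOn κ J (r + 1))
  rw [← h0]
  refine sum_congr (filter_congr fun p hp => ?_) fun _ _ => rfl
  obtain ⟨hp1, hp2⟩ := mem_product.1 hp
  constructor
  · rintro ⟨h1, h2⟩
    funext r
    rw [← psumOn_union_inter, h1, h2, psumOn_union_inter]
  · intro hr
    have key := hκ.2 ⟨p.1, (mem_powersetCard.1 hp1).2⟩ ⟨p.2, (mem_powersetCard.1 hp2).2⟩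
      ⟨I, hI⟩ ⟨J, hJ⟩
    refine key fun v hv => ?_
    obtain ⟨h1, h2⟩ := mem_Icc.1 hv
    -- The power `v` belongs to the coordinate with index `v - 1`.
    have h3 : psumOn κ p.1 (v - 1 + 1) + psumOn κ p.2 (v - 1 + 1) =
        psumOn κ I (v - 1 + 1) + psumOn κ J (v - 1 + 1) := congrFun hr ⟨v - 1, by omega⟩
    rw [Nat.sub_add_cancel h1] at h3
    exact h3

end Coefficients

/-! ### Pairs of sets with given union and intersection. -/

section Pairs

variable {E : Type*} [DecidableEq E]

theorem sum_pairs_eq_sum_powersetCard [Fintype E] {k : ℕ} {N S : Finset E} (hNS : Disjoint N S)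
    (hS : #S = 4) (hk : #N + 2 = k) (Q : Finset E → Finset E → ℝ) :
    ∑ p ∈ powersetCard k univ ×ˢ powersetCard k univ with p.1 ∪ p.2 = N ∪ S ∧ p.1 ∩ p.2 = N,
      Q p.1 p.2 = ∑ X ∈ powersetCard 2 S, Q (N ∪ X) (N ∪ S \ X) := by
  symm
  refine sum_bij' (fun X _ => (N ∪ X, N ∪ S \ X)) (fun p _ => p.1 \ N) ?_ ?_ ?_ ?_ ?_
  · intro X hX
    obtain ⟨h1, h2⟩ := mem_powersetCard.1 hX
    simp only [mem_filter, mem_product, mem_powersetCard_univ]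
    refine ⟨⟨?_, ?_⟩, ?_, ?_⟩
    · rw [card_union_of_disjoint (hNS.mono_right h1), h2, hk]
    · rw [card_union_of_disjoint (hNS.mono_right sdiff_subset), card_sdiff_of_subset h1, h2, hS, hk]
    · rw [← union_union_distrib_left, union_sdiff_of_subset h1]
    · rw [← union_inter_distrib_left, inter_sdiff_self, union_empty]
  · rintro ⟨I, J⟩ hp
    simp only [mem_filter, mem_product, mem_powersetCard_univ] at hp
    obtain ⟨⟨hI, hJ⟩, hU, hN⟩ := hp
    have hNI : N ⊆ I := hN ▸ inter_subset_left
    refine mem_powersetCard.2 ⟨?_, ?_⟩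
    · intro y hy
      obtain ⟨h1, h2⟩ := mem_sdiff.1 hy
      exact (mem_union.1 (hU ▸ mem_union_left J h1)).resolve_left h2
    · rw [card_sdiff_of_subset hNI]
      omega
  · intro X hX
    change (N ∪ X) \ N = X
    rw [union_sdiff_left, Finset.sdiff_eq_self_iff_disjoint]
    exact (hNS.mono_right (mem_powersetCard.1 hX).1).symm
  · rintro ⟨I, J⟩ hp
    obtain ⟨-, hU, hN⟩ := mem_filter.1 hp
    have hNI : N ⊆ I := hN ▸ inter_subset_left
    have hNJ : N ⊆ J := hN ▸ inter_subset_right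
    refine Prod.ext (union_sdiff_of_subset hNI) ?_
    ext y
    have h1 := Finset.ext_iff.1 hU y
    have h2 := Finset.ext_iff.1 hN y
    have h3 : y ∈ N → y ∉ S := fun h => disjoint_left.1 hNS h
    simp only [mem_union, mem_inter] at h1 h2
    simp only [mem_union, mem_sdiff]
    tauto
  · intro X _
    rfl

/-- The pairs correspond to the six 2-subsets of `{a, b, c, d}`; complementary subsets give the same
value, which leaves three splittings counted twice. -/
theorem sum_pairs_eq [Fintype E] {k : ℕ} {N : Finset E} {a b c d : E} (ha : a ∉ N) (hb : b ∉ N)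
    (hc : c ∉ N) (hd : d ∉ N) (hab : a ≠ b) (hac : a ≠ c) (had : a ≠ d) (hbc : b ≠ c) (hbd : b ≠ d)
    (hcd : c ≠ d) (hk : #N + 2 = k) (Q : Finset E → Finset E → ℝ) (hQ : ∀ I J, Q I J = Q J I) :
    ∑ p ∈ powersetCard k univ ×ˢ powersetCard k univ with
      p.1 ∪ p.2 = insert a (insert b N) ∪ insert c (insert d N) ∧
        p.1 ∩ p.2 = insert a (insert b N) ∩ insert c (insert d N), Q p.1 p.2 =
    2 * (Q (insert a (insert b N)) (insert c (insert d N)) +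
      Q (insert a (insert c N)) (insert b (insert d N)) +
      Q (insert a (insert d N)) (insert b (insert c N))) := by
  have hinj : Function.Injective ![a, b, c, d] := by
    intro i j h
    fin_cases i <;> fin_cases j <;> simp_all
  let g : Fin 4 ↪ E := ⟨![a, b, c, d], hinj⟩
  have hS : (univ : Finset (Fin 4)).map g = {a, b, c, d} := by
    rw [show (univ : Finset (Fin 4)) = {0, 1, 2, 3} by decide]
    simp [g]
  have hU : insert a (insert b N) ∪ insert c (insert d N) = N ∪ univ.map g := by
    rw [hS]
    ext y
    simp only [mem_union, mem_insert, mem_singleton]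
    tauto
  have hN : insert a (insert b N) ∩ insert c (insert d N) = N := by
    rw [insert_inter_of_notMem (by simp [ha, hac, had]),
      insert_inter_of_notMem (by simp [hb, hbc, hbd])]
    exact inter_eq_left.2 ((subset_insert _ _).trans (subset_insert _ _))
  have hdisj : Disjoint N (univ.map g) := by
    rw [hS]
    simp [ha, hb, hc, hd]
  rw [hU, hN, sum_pairs_eq_sum_powersetCard hdisj (by simp) hk, powersetCard_map, sum_map]
  have h6 : powersetCard 2 (univ : Finset (Fin 4)) =
      {{0, 1}, {2, 3}, {0, 2}, {1, 3}, {0, 3}, {1, 2}} := by decide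
  have hc6 : ∀ X : Finset (Fin 4), (univ.map g) \ X.map g = (univ \ X).map g := fun X =>
    (Finset.map_sdiff ..).symm
  have h2 : ∀ i j : Fin 4, N ∪ ({i, j} : Finset (Fin 4)).map g = insert (g i) (insert (g j) N) := by
    intro i j
    rw [map_insert, map_singleton, union_comm, insert_union, singleton_union]
  simp only [RelEmbedding.coe_toEmbedding, mapEmbedding_apply, hc6]
  rw [h6, sum_insert (by decide), sum_insert (by decide), sum_insert (by decide),
    sum_insert (by decide), sum_insert (by decide), sum_singleton,
    show (univ \ {0, 1} : Finset (Fin 4)) = {2, 3} by decide,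
    show (univ \ {2, 3} : Finset (Fin 4)) = {0, 1} by decide,
    show (univ \ {0, 2} : Finset (Fin 4)) = {1, 3} by decide,
    show (univ \ {1, 3} : Finset (Fin 4)) = {0, 2} by decide,
    show (univ \ {0, 3} : Finset (Fin 4)) = {1, 2} by decide,
    show (univ \ {1, 2} : Finset (Fin 4)) = {0, 3} by decide]
  simp only [h2]
  change Q (insert a (insert b N)) (insert c (insert d N)) +
    (Q (insert c (insert d N)) (insert a (insert b N)) +
    (Q (insert a (insert c N)) (insert b (insert d N)) +
    (Q (insert b (insert d N)) (insert a (insert c N)) +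
    (Q (insert a (insert d N)) (insert b (insert c N)) +
      Q (insert b (insert c N)) (insert a (insert d N)))))) = _
  rw [hQ (insert c (insert d N)), hQ (insert b (insert d N)), hQ (insert b (insert c N))]
  ring

end Pairs

/-! ### From solitonic signatures to compatible signs, and back. -/

noncomputable section Main

variable {n k d : ℕ}

/-- The maximal minor `colMinor A I`, or `0` if `I` does not have `k` elements. -/
def minorOn (A : Matrix (Fin k) (Fin n) ℝ) (I : Finset (Fin n)) : ℝ :=
  if h : #I = k then colMinor A ⟨I, h⟩ else 0

/-- The Vandermonde minor `vdmMinor κ I`, or `0` if `I` does not have `k` elements. -/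
def vdmOn (k : ℕ) (κ : Fin n → ℝ) (I : Finset (Fin n)) : ℝ :=
  if h : #I = k then vdmMinor κ (k := k) ⟨I, h⟩ else 0

theorem minorOn_val (A : Matrix (Fin k) (Fin n) ℝ) (I : KSubset n k) :
    minorOn A I.1 = colMinor A I := dif_pos I.2

theorem vdmOn_val (κ : Fin n → ℝ) (I : KSubset n k) : vdmOn k κ I.1 = vdmMinor κ I := dif_pos I.2

theorem vdmOn_ne_zero {κ : Fin n → ℝ} (hκ : Function.Injective κ) {I : Finset (Fin n)}
    (hI : #I = k) : vdmOn k κ I ≠ 0 := by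
  rw [vdmOn, dif_pos hI]
  exact Matrix.det_vandermonde_ne_zero_iff.2 (hκ.comp (I.orderEmbOfFin hI).injective)

theorem minorOn_ne_zero_iff (A : Matrix (Fin k) (Fin n) ℝ) (I : Finset (Fin n)) :
    minorOn A I ≠ 0 ↔ #I = k ∧ LinearIndepOn ℝ (fun α l => A l α) (I : Set (Fin n)) := by
  by_cases hI : #I = k
  · rw [minorOn, dif_pos hI, colMinor, ← isUnit_iff_ne_zero, ← Matrix.isUnit_iff_isUnit_det,
      ← Matrix.linearIndependent_cols_iff_isUnit]
    simp only [hI, true_and]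
    exact linearIndependent_equiv (R := ℝ) (f := fun α : (I : Set (Fin n)) => fun l => A l α)
      (I.orderIsoOfFin hI).toEquiv
  · simp [minorOn, hI]

theorem exists_exch_minorOn_ne_zero (A : Matrix (Fin k) (Fin n) ℝ) {B B' : Finset (Fin n)}
    (hB : minorOn A B ≠ 0) (hB' : minorOn A B' ≠ 0) {c : Fin n} (hc : c ∈ B') (hcB : c ∉ B) :
    ∃ x ∈ B, x ∉ B' ∧ minorOn A (exch B x c) ≠ 0 := by
  rw [minorOn_ne_zero_iff] at hB hB'
  have hli : LinearIndepOn ℝ (fun α l => A l α) ((insert c (B ∩ B') : Finset (Fin n)) : Set (Fin n)) :=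
    hB'.2.mono (by exact_mod_cast insert_subset hc inter_subset_right)
  have hsub : ((insert c (B ∩ B') : Finset (Fin n)) : Set (Fin n)) ⊆
      ((insert c B : Finset (Fin n)) : Set (Fin n)) := by
    exact_mod_cast insert_subset_insert c inter_subset_left
  -- The independent set `insert c (B ∩ B')` is completed to a basis inside `insert c B`. It must
  -- omit one element of `B`, and that element lies outside `B'` because `B ∩ B'` was kept.
  obtain ⟨b, hb1, hb2, hb3, hb4⟩ := exists_linearIndepOn_extension hli hsub
  lift b to Finset (Fin n) using b.toFinite
  have hb1 : b ⊆ insert c B := by exact_mod_cast hb1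
  have hb2 : insert c (B ∩ B') ⊆ b := by exact_mod_cast hb2
  have card_span : ∀ s : Finset (Fin n), LinearIndepOn ℝ (fun α l => A l α) (s : Set (Fin n)) →
      Module.finrank ℝ (Submodule.span ℝ ((fun α l => A l α) '' (s : Set (Fin n)))) = #s := by
    intro s hs
    rw [Set.image_eq_range]
    exact (finrank_span_eq_card hs).trans (by simp)
  have hbk : #b = k := by
    refine le_antisymm ?_ ?_
    · rw [← card_span b hb4]
      exact (Submodule.finrank_le _).trans (by simp)
    · refine hB.1.ge.trans ?_
      rw [← card_span b hb4, ← card_span B hB.2]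
      refine Submodule.finrank_mono (Submodule.span_le.2 ?_)
      refine subset_trans ?_ hb3
      exact Set.image_mono (by exact_mod_cast subset_insert c B)
  obtain ⟨x, hx, hxb⟩ : ∃ x ∈ B, x ∉ b := by
    by_contra! hcon
    have : insert c B ⊆ b := insert_subset (hb2 (mem_insert_self _ _)) hcon
    have := card_le_card this
    rw [card_insert_of_notMem hcB, hB.1, hbk] at this
    omega
  have hxB' : x ∉ B' := fun h => hxb (hb2 (mem_insert_of_mem (mem_inter.2 ⟨hx, h⟩)))
  refine ⟨x, hx, hxB', ?_⟩
  have hcx : c ∉ B.erase x := fun h => hcB (mem_of_mem_erase h)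
  have : b = exch B x c := by
    refine eq_of_subset_of_card_le (fun y hy => ?_) ?_
    · rcases mem_insert.1 (hb1 hy) with rfl | h
      · exact mem_insert_self _ _
      · exact mem_exch_of_ne h (by rintro rfl; exact hxb hy)
    · rw [exch, card_insert_of_notMem hcx, card_erase_add_one hx, hB.1, hbk]
  rw [← this, minorOn_ne_zero_iff]
  exact ⟨hbk, hb4⟩

theorem sum_kSubset {M : Type*} [AddCommMonoid M] (g : Finset (Fin n) → M) :
    ∑ I : KSubset n k, g I.1 = ∑ I ∈ powersetCard k univ, g I :=
  (sum_subtype (p := fun I : Finset (Fin n) => #I = k) _ (fun _ => mem_powersetCard_univ) g).symm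

theorem sum_phase (κ : Fin n → ℝ) (I : Finset (Fin n)) (x : Fin d → ℝ) :
    ∑ α ∈ I, phase κ α x = ∑ r : Fin d, psumOn κ I (r + 1) * x r := by
  simp only [phase, psumOn, sum_mul]
  exact sum_comm

theorem signedTau_eq_expSum (κ : Fin n → ℝ) (A : Matrix (Fin k) (Fin n) ℝ) (S : Signature A)
    (f : Finset (Fin n) → ℤˣ) (hf : ∀ I : nonvanishing A, f I.1.1 = S I) :
    signedTau (d := d) κ A S = expSum d κ (powersetCard k univ)
      fun I => ((f I : ℤ) : ℝ) * (minorOn A I * vdmOn k κ I) := by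
  classical
  funext x
  rw [expSum, ← sum_kSubset, signedTau]
  symm
  have : ∀ I : KSubset n k, I ∉ (nonvanishing A).toFinset →
      (((f I.1 : ℤˣ) : ℤ) : ℝ) * (minorOn A I.1 * vdmOn k κ I.1) *
        Real.exp (∑ r : Fin d, psumOn κ I.1 (r + 1) * x r) = 0 := by
    intro I hI
    have : colMinor A I = 0 := by
      by_contra h
      exact hI (Set.mem_toFinset.2 h)
    simp [minorOn_val, this]
  rw [← sum_subset (subset_univ (nonvanishing A).toFinset) fun I _ hI => this I hI,
    ← Finset.sum_set_coe (nonvanishing A)]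
  refine sum_congr (by ext; simp) fun I _ => ?_
  rw [hf, minorOn_val, vdmOn_val, sum_phase]

theorem colMinor_mul_diagonal (A : Matrix (Fin k) (Fin n) ℝ) (θ : Fin n → ℝ) (I : KSubset n k) :
    colMinor (A * Matrix.diagonal θ) I = (∏ α ∈ I.1, θ α) * colMinor A I := by
  rw [colMinor, colMinor]
  have hp : ∏ α ∈ I.1, θ α = ∏ i, θ (I.1.orderEmbOfFin I.2 i) := by
    conv_lhs => rw [← map_orderEmbOfFin_univ I.1 I.2]
    rw [prod_map]
    rfl
  rw [hp]
  refine Eq.trans ?_ (Matrix.det_mul_row (fun i => θ (I.1.orderEmbOfFin I.2 i)) _)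
  congr 1
  ext l i
  simp [mul_comm]

/-- The unsigned coefficients solve the bilinear KP equation. -/
theorem hirotaKP_tau_eq_zero (hd : 3 ≤ d) (κ : Fin n → ℝ) (A : Matrix (Fin k) (Fin n) ℝ)
    (x : Fin d → ℝ) :
    hirotaKP hd (expSum d κ (powersetCard k univ) fun I => minorOn A I * vdmOn k κ I)
      (expSum d κ (powersetCard k univ) fun I => minorOn A I * vdmOn k κ I) x = 0 := by
  -- At a fixed point `x` the exponentials are absorbed into the columns of `A`, which reduces the
  -- claim to the algebraic identity `sum_kpSymbol_eq_zero`.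
  let θ : Fin n → ℝ := fun α => Real.exp (phase κ α x)
  have hM : ∀ I : KSubset n k, colMinor (A * Matrix.diagonal θ) I =
      colMinor A I * Real.exp (∑ r : Fin d, psumOn κ I.1 (r + 1) * x r) := by
    intro I
    rw [colMinor_mul_diagonal, ← sum_phase, Real.exp_sum, mul_comm]
  have := sum_kpSymbol_eq_zero κ (A * Matrix.diagonal θ)
  rw [hirotaKP_expSum, sum_product, ← sum_kSubset, ← this]
  refine sum_congr rfl fun I _ => ?_
  rw [← sum_kSubset]
  refine sum_congr rfl fun J _ => ?_
  simp only [hM, minorOn_val, vdmOn_val, add_mul, sum_add_distrib, Real.exp_add]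
  ring

theorem kpSymbol_pair (κ : Fin n → ℝ) {N : Finset (Fin n)} {a b c d : Fin n} (ha : a ∉ N)
    (hb : b ∉ N) (hc : c ∉ N) (hd : d ∉ N) (hab : a ≠ b) (hcd : c ≠ d) :
    kpSymbol κ (insert a (insert b N)) (insert c (insert d N)) =
      12 * ((κ a - κ c) * (κ a - κ d) * (κ b - κ c) * (κ b - κ d)) := by
  have h : ∀ r y z, y ∉ N → z ∉ N → y ≠ z →
      psumOn κ (insert y (insert z N)) r = κ y ^ r + κ z ^ r + psumOn κ N r := by
    intro r y z hy hz hyz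
    rw [psumOn, sum_insert (by simp [hy, hyz]), sum_insert hz, psumOn]
    ring
  simp only [kpSymbol, h _ a b ha hb hab, h _ c d hc hd hcd]
  ring

theorem kpSymbol_comm (κ : Fin n → ℝ) (I J : Finset (Fin n)) : kpSymbol κ I J = kpSymbol κ J I := by
  simp only [kpSymbol]
  ring

/-- The three-term relation for the coefficients of an exponential sum that solves the bilinear KP
equation. -/
theorem IsGeneric.three_term {κ : Fin n → ℝ} (hκ : IsGeneric k d κ) (hd : 3 ≤ d)
    (C : Finset (Fin n) → ℝ)
    (h : ∀ x : Fin d → ℝ, hirotaKP hd (expSum d κ (powersetCard k univ) C)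
      (expSum d κ (powersetCard k univ) C) x = 0) (N : Finset (Fin n)) (a b c e : Fin n)
    (ha : a ∉ N) (hb : b ∉ N) (hc : c ∉ N) (he : e ∉ N) (hab : a ≠ b) (hac : a ≠ c) (hae : a ≠ e)
    (hbc : b ≠ c) (hbe : b ≠ e) (hce : c ≠ e) (hk : #N + 2 = k) :
    C (insert a (insert b N)) * C (insert c (insert e N)) *
        kpSymbol κ (insert a (insert b N)) (insert c (insert e N)) +
      C (insert a (insert c N)) * C (insert b (insert e N)) *
        kpSymbol κ (insert a (insert c N)) (insert b (insert e N)) +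
      C (insert a (insert e N)) * C (insert b (insert c N)) *
        kpSymbol κ (insert a (insert e N)) (insert b (insert c N)) = 0 := by
  have card2 : ∀ y z, y ∉ N → z ∉ N → y ≠ z → #(insert y (insert z N)) = k := by
    intro y z hy hz hyz
    rw [card_insert_of_notMem (by simp [hy, hyz]), card_insert_of_notMem hz, ← hk]
  have h1 := hκ.sum_kpSymbol_eq_zero hd C h (card2 a b ha hb hab) (card2 c e hc he hce)
  have h2 := sum_pairs_eq ha hb hc he hab hac hae hbc hbe hce hk
    (fun I J => C I * C J * kpSymbol κ I J) fun I J => by rw [kpSymbol_comm, mul_comm (C I)]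
  linarith

open Classical in
/-- The signs of a signature, extended by `1`. -/
def signOn {A : Matrix (Fin k) (Fin n) ℝ} (S : Signature A) (I : Finset (Fin n)) : ℤˣ :=
  if h : ∃ hI : #I = k, colMinor A ⟨I, hI⟩ ≠ 0 then S ⟨⟨I, h.1⟩, h.2⟩ else 1

theorem signOn_val {A : Matrix (Fin k) (Fin n) ℝ} (S : Signature A) (I : nonvanishing A) :
    signOn S I.1.1 = S I := dif_pos ⟨I.1.2, I.2⟩

/-- If `s ≠ t`, then `u` equals one of them, and combining the two relations kills the term with the
other sign. The third term may be zero. -/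
theorem units_eq_of_three_term {s t u : ℤˣ} {x y z : ℝ} (hx : x ≠ 0) (hy : y ≠ 0)
    (h : x + y + z = 0)
    (h' : ((s : ℤ) : ℝ) * x + ((t : ℤ) : ℝ) * y + ((u : ℤ) : ℝ) * z = 0) : s = t := by
  rcases Int.units_eq_one_or s with rfl | rfl <;> rcases Int.units_eq_one_or t with rfl | rfl <;>
    rcases Int.units_eq_one_or u with rfl | rfl <;> push_cast at h' <;>
    first
    | rfl
    | exact absurd (by linarith) hx
    | exact absurd (by linarith) hy

theorem signsCompatible_of_isSolitonic (hd : 3 ≤ d) {κ : Fin n → ℝ} (hκ : IsGeneric k d κ)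
    {A : Matrix (Fin k) (Fin n) ℝ} {S : Signature A} (hS : IsSolitonic hd κ A S) :
    SignsCompatible (fun I => minorOn A I ≠ 0) (signOn S) := by
  have h0 := hκ.three_term hd _ (hirotaKP_tau_eq_zero hd κ A)
  rw [IsSolitonic, signedTau_eq_expSum κ A S _ (signOn_val S)] at hS
  have h1 := hκ.three_term hd _ hS
  have hcard : ∀ (N : Finset (Fin n)) (a b : Fin n), a ∉ N → b ∉ N → a ≠ b →
      minorOn A (insert a (insert b N)) ≠ 0 → #N + 2 = k := by
    intro N a b ha hb hab h
    have := ((minorOn_ne_zero_iff A _).1 h).1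
    rwa [card_insert_of_notMem (by simp [ha, hab]), card_insert_of_notMem hb] at this
  have hQ : ∀ (N : Finset (Fin n)) (a b c e : Fin n), a ∉ N → b ∉ N → c ∉ N → e ∉ N →
      a ≠ b → a ≠ c → a ≠ e → b ≠ c → b ≠ e → c ≠ e → #N + 2 = k →
      ((minorOn A (insert a (insert b N)) * vdmOn k κ (insert a (insert b N))) *
        (minorOn A (insert c (insert e N)) * vdmOn k κ (insert c (insert e N))) *
        kpSymbol κ (insert a (insert b N)) (insert c (insert e N)) = 0 ↔
      ¬ (minorOn A (insert a (insert b N)) ≠ 0 ∧ minorOn A (insert c (insert e N)) ≠ 0)) := by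
    intro N a b c e ha hb hc he hab hac hae hbc hbe hce hk
    have v1 : vdmOn k κ (insert a (insert b N)) ≠ 0 := vdmOn_ne_zero hκ.1 (by
      rw [card_insert_of_notMem (by simp [ha, hab]), card_insert_of_notMem hb, ← hk])
    have v2 : vdmOn k κ (insert c (insert e N)) ≠ 0 := vdmOn_ne_zero hκ.1 (by
      rw [card_insert_of_notMem (by simp [hc, hce]), card_insert_of_notMem he, ← hk])
    have hs : kpSymbol κ (insert a (insert b N)) (insert c (insert e N)) ≠ 0 := by
      rw [kpSymbol_pair κ ha hb hc he hab hce]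
      simp [sub_eq_zero, hκ.1.eq_iff, hac, hae, hbc, hbe]
    simp only [mul_eq_zero, v1, v2, hs, or_false]
    tauto
  refine ⟨?_, ?_, fun B B' hB hB' c hc hcB => exists_exch_minorOn_ne_zero A hB hB' hc hcB⟩
  · intro N a b c e ha hb hc he hab hac hae hbc hbe hce hb1 hb2
    have hk := hcard N a b ha hb hab hb1
    have h := h0 N a b c e ha hb hc he hab hac hae hbc hbe hce hk
    have q1 := hQ N a b c e ha hb hc he hab hac hae hbc hbe hce hk
    have q2 := hQ N a c b e ha hc hb he hac hab hae hbc.symm hce hbe hk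
    have q3 := hQ N a e b c ha he hb hc hae hab hac hbe.symm hce.symm hbc hk
    by_contra hcon
    rw [q2.2 fun hh => hcon (Or.inl hh), q3.2 fun hh => hcon (Or.inr hh), add_zero, add_zero] at h
    exact q1.1 h ⟨hb1, hb2⟩
  · intro N a b c e ha hb hc he hab hac hae hbc hbe hce hb1 hb2 hb3 hb4
    have hk := hcard N a b ha hb hab hb1
    have h := h0 N a b c e ha hb hc he hab hac hae hbc hbe hce hk
    have h' := h1 N a b c e ha hb hc he hab hac hae hbc hbe hce hk
    have q1 := mt (hQ N a b c e ha hb hc he hab hac hae hbc hbe hce hk).1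
      (not_not.2 ⟨hb1, hb2⟩)
    have q2 := mt (hQ N a c b e ha hc hb he hac hab hae hbc.symm hce hbe hk).1
      (not_not.2 ⟨hb3, hb4⟩)
    refine units_eq_of_three_term (u := signOn S (insert a (insert e N)) *
      signOn S (insert b (insert c N))) q1 q2 h ?_
    simp only [Units.val_mul, Int.cast_mul]
    linear_combination h'

theorem isCompleteSolitonic_prod (hd : 3 ≤ d) (κ : Fin n → ℝ) (e : ℤˣ) (s : Fin n → ℤˣ) :
    IsCompleteSolitonic (k := k) hd κ fun I => e * ∏ i ∈ I.1, s i := by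
  intro B _ x
  let θ : Fin n → ℝ := fun α => ((s α : ℤ) : ℝ)
  rw [signedTau_eq_expSum κ B _ (fun I => e * ∏ i ∈ I, s i) fun _ => rfl]
  have h := hirotaKP_tau_eq_zero hd κ (B * Matrix.diagonal θ) x
  rw [hirotaKP_expSum] at h ⊢
  rw [← h]
  refine sum_congr rfl fun p hp => ?_
  obtain ⟨hp1, hp2⟩ := mem_product.1 hp
  have hm : ∀ I ∈ powersetCard k (univ : Finset (Fin n)),
      minorOn (B * Matrix.diagonal θ) I = (∏ i ∈ I, θ i) * minorOn B I := by
    intro I hI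
    have hI := (mem_powersetCard.1 hI).2
    rw [minorOn, minorOn, dif_pos hI, dif_pos hI, colMinor_mul_diagonal]
  have he : ((e : ℤ) : ℝ) * ((e : ℤ) : ℝ) = 1 := by
    rw [← Int.cast_mul, ← Units.val_mul, Int.units_mul_self, Units.val_one, Int.cast_one]
  rw [hm _ hp1, hm _ hp2]
  push_cast
  linear_combination (∏ i ∈ p.1, θ i) * (∏ i ∈ p.2, θ i) * minorOn B p.1 * minorOn B p.2 *
    vdmOn k κ p.1 * vdmOn k κ p.2 * kpSymbol κ p.1 p.2 *
    Real.exp (∑ r : Fin d, (psumOn κ p.1 (r + 1) + psumOn κ p.2 (r + 1)) * x r) * he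

end Main

end KPSigns

theorem mainTheorem5 (n k d : ℕ) (hd : 3 ≤ d) (κ : Fin n → ℝ) (hκ : KPSigns.IsGeneric k d κ)
    (A : Matrix (Fin k) (Fin n) ℝ) (hA : A.rank = k)
    (S : KPSigns.Signature A) (hS : KPSigns.IsSolitonic hd κ A S) :
    ∃ T : KPSigns.KSubset n k → ℤˣ,
      (∀ I : KPSigns.nonvanishing A, T I.1 = S I) ∧ KPSigns.IsCompleteSolitonic hd κ T := by
  have hc := KPSigns.signsCompatible_of_isSolitonic hd hκ hS
  by_cases hne : ∃ B₀, KPSigns.minorOn A B₀ ≠ 0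
  · obtain ⟨B₀, hB₀⟩ := hne
    obtain ⟨e, s, h⟩ := hc.exists_prod_eq hB₀
    refine ⟨fun I => e * ∏ i ∈ I.1, s i, fun I => ?_, KPSigns.isCompleteSolitonic_prod hd κ e s⟩
    rw [← KPSigns.signOn_val S I, h I.1.1 (by rw [KPSigns.minorOn_val]; exact I.2)]
  -- Without nonzero minors there is nothing to extend, and the constant signature serves.
  · refine ⟨fun I => 1 * ∏ i ∈ I.1, (1 : Fin n → ℤˣ) i, fun I => ?_,
      KPSigns.isCompleteSolitonic_prod hd κ 1 1⟩
    exact absurd ⟨I.1.1, by rw [KPSigns.minorOn_val]; exact I.2⟩ hne
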